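/- **Setting.** Boolean polynomials are the elements of $\mathbb F_2[x_1,\dots,x_n]/\langle x_1^2+x_1,\dots,x_n^2+x_n\rangle$, written uniquely as sums of distinct square-free monomials. The class $\mathrm{cls}(P)$ is the largest $c$ such that $x_c$ occurs in $P$ ($0$ for constants). If $c=\mathrm{cls}(P)>0$, write $P=Ix_c+U$ with $I,U$ free of $x_c$; $P$ is *monic* if $I=1$. $P$ is *linear* if its total degree is $1$. **Algorithm TriSet.** The input is a finite set $\mathbb P$ of Boolean polynomials. The parameters are a threshold $t\in\mathbb N$ and a function Choose which picks a non-monic element from every polynomial set that contains one. Put $\mathcal A=\emptyset$, $\mathbb P^*=\emptyset$, and let $n_{monic}$ be the number of monic elements of $\mathbb P$. While $\mathbb P\neq\emptyset$: 1. (Simplify) As long as $1\notin\mathbb P$ and $\mathbb P$ has a linear element, take one, $x_c+L$ of class $c$, out of $\mathbb P$, substitute $L$ for $x_c$ in all other elements of $\mathbb P$, and put $x_c+L$ into $\mathcal A$. If $1\in\mathbb P$ at any moment, return $\emptyset$ and $\mathbb P^*$. Afterwards discard the polynomial $0$ from $\mathbb P$. 2. If $n_{monic}\ge t$, replace the set of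 monic elements of $\mathbb P$ by the result of AddReduce applied to it. 3. If all elements of $\mathbb P$ are monic and have different classes, return $\mathcal A\cup\mathbb P$ and $\mathbb P^*$. If all are monic but two have the same class, replace $\mathbb P$ by AddReduce$(\mathbb P)$ and continue with the next iteration. 4. Otherwise let $P=Ix_c+U$ be the polynomial picked by Choose from $\mathbb P$, $c=\mathrm{cls}(P)$. Add the system $(\mathbb P\setminus\{P\})\cup\mathcal A\cup\{I,U\}$ to $\mathbb P^*$, replace $\mathbb P$ by $(\mathbb P\setminus\{P\})\cup\{x_c+U,\,I+1\}$, and increase $n_{monic}$ by $1$. When the loop ends, return $\mathcal A$ and $\mathbb P^*$. AddReduce treats the classes of its input one after the other: in each class it keeps one element $Q$ of lowest total degree and replaces every other element $R$ by $R+Q$, dropping zero sums; if some $R+Q=1$, TriSet returns $\emptyset$ and $\mathbb P^*$. All choices other than that of Choose are arbitrary. **Cost.** A polynomial is stored as the sorted list of its monomials, each a vector of $n$ bits; comparing, multiplying or copying a monomial costs $n$ bit operations. Sums are computed by merging sorted lists. To substitute $L$ for $x_c$ in $Ix_c+U$, one computes all products of a monomial of $I$ with a monomial of $L$, adds them up by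 merge sort (cancelling equal monomials in pairs), and merges the result with $U$. Writing $P$ as $Ix_c+U$ costs $n$ per monomial of $P$. Putting a polynomial with $s$ monomials into a polynomial set, or taking it out, costs $ns+1$. Polynomial sets are kept as search trees indexed by class, degree, and the properties of being constant, linear or monic, with old versions sharing data with new ones, so that systems put into $\mathbb P^*$ need not be copied; each control step, including tests on this index, costs $1$ or $n+1$. The evaluation of Choose is not charged. The bit-size complexity of TriSet on an input is the maximal total number of bit operations of an execution. **Theorem.** (a) There is an absolute constant $C$ such that for all integers $n\ge2$, $d\ge1$, $m\ge1$, every set of $m$ Boolean polynomials in $n$ variables of total degree at most $d$, every Choose function and every threshold $t$, every execution of TriSet on this input halts, and the bit-size complexity is at most $C\,d\,m\,n^{2d+3}\log n$. (b) Consequently TriSet is a polynomial-time algorithm in $n$ for fixed $d$: for every $d\ge 0$ there is a polynomial $p$ with coefficients in $\mathbb N$ such that for all $n\ge0$, $m\ge1$, every set of $m$ Boolean polynomials in $n$ variables of total degree at most $d$, every Choose function and every threshold $t$, every execution of TriSet halts after at most $m\,p(n)$ bit operations. -/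

import Mathlib

namespace TriSet

/-! ### Computations that count bit operations -/

/-- A value together with the number of bit operations spent on computing it. -/
structure Timed (α : Type) where
  val : α
  cost : ℕ

/-- Sequential composition adds the costs. -/
instance : Monad Timed where
  pure a := ⟨a, 0⟩
  bind x f := ⟨(f x.val).val, x.cost + (f x.val).cost⟩

/-- Spend `k` bit operations. -/
def tick (k : ℕ) : Timed Unit := ⟨(), k⟩

/-! ### Boolean polynomials

An element of `𝔽₂[x₁,…,xₙ]/⟨x₁²+x₁,…,xₙ²+xₙ⟩` is uniquely a sum of distinct square-free monomials.
The variable `x_{i+1}` is the index `i : Fin n`. -/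

/-- A square-free monomial: the set of its variables, i.e. an exponent vector of `n` bits.
The type carries the linear order that compares these vectors from the bit of `xₙ` downwards. -/
abbrev Mono (n : ℕ) : Type := Colex (Finset (Fin n))

/-- A Boolean polynomial in `n` variables: the finite set of its monomials (`∅` is `0`). It is
stored as the increasing list `p.sort` of its monomials, each a vector of `n` bits. -/
abbrev BoolPoly (n : ℕ) : Type := Finset (Mono n)

/-- A (finite) polynomial system. -/
abbrev PolySet (n : ℕ) : Type := Finset (BoolPoly n)

section Polynomials

variable {n : ℕ}

/-- The monomial `1`. -/
def oneMono : Mono n := toColex ∅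

/-- The polynomial `1`. -/
def one : BoolPoly n := {oneMono}

/-- The polynomial `x_c`. -/
def var (c : Fin n) : BoolPoly n := {toColex {c}}

/-- Total degree. -/
def tdeg (p : BoolPoly n) : ℕ := p.sup fun t => (ofColex t).card

/-- The class: the largest `c` such that `x_c` (the index `c - 1`) occurs, and `0` for constants. -/
def cls (p : BoolPoly n) : ℕ := p.sup fun t => (ofColex t).sup fun i => (i : ℕ) + 1

/-- The `I` in `p = I x_c + U` with `I`, `U` free of `x_c`. -/
def coeffPart (c : Fin n) (p : BoolPoly n) : BoolPoly n :=
  (p.filter fun t => c ∈ ofColex t).image fun t => toColex ((ofColex t).erase c)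

/-- The `U` in `p = I x_c + U` with `I`, `U` free of `x_c`. -/
def restPart (c : Fin n) (p : BoolPoly n) : BoolPoly n :=
  p.filter fun t => c ∉ ofColex t

/-- `p` is not constant and its initial, the coefficient of its leading variable, is `1`. -/
def Monic (p : BoolPoly n) : Prop :=
  ∃ c : Fin n, cls p = c + 1 ∧ coeffPart c p = one

instance (p : BoolPoly n) : Decidable (Monic p) := by unfold Monic; infer_instance

/-- `p` has total degree `1`, i.e. `p = x_c + L` with `c` the class of `p`. -/
def Linear (p : BoolPoly n) : Prop := tdeg p = 1

/-! ### Arithmetic, with its bit operations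

Comparing, multiplying or copying monomials, i.e. vectors of `n` bits, takes `n` bit operations. -/

/-- The sum over `𝔽₂` of two increasing lists of monomials by merging; equal monomials cancel. -/
def mergeT : List (Mono n) → List (Mono n) → Timed (List (Mono n))
  | [], ys => do
      tick (n * ys.length)
      return ys
  | x :: xs, [] => do
      tick (n * (x :: xs).length)
      return x :: xs
  | x :: xs, y :: ys => do
      tick n
      if x = y then
        mergeT xs ys
      else if x < y then do
        tick n
        let zs ← mergeT xs (y :: ys)
        return x :: zs
      else do
        tick n
        let zs ← mergeT (x :: xs) ys
        return y :: zs
  termination_by xs ys => xs.length + ys.length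

/-- The sum over `𝔽₂` of an arbitrary list of monomials, as an increasing list: merge sort. -/
def sumT : List (Mono n) → Timed (List (Mono n))
  | [] => return []
  | [x] => return [x]
  | x :: y :: l => do
      tick (n * (x :: y :: l).length)
      let us ← sumT ((x :: y :: l).take ((l.length + 2) / 2))
      let vs ← sumT ((x :: y :: l).drop ((l.length + 2) / 2))
      mergeT us vs
  termination_by l => l.length
  decreasing_by
    all_goals simp only [List.length_take, List.length_drop, List.length_cons]; omega

/-- All products of a monomial of `p` and a monomial of `q`, multiplied out one by one. -/
def productsT (p q : BoolPoly n) : Timed (List (Mono n)) := do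
  tick (n * (p.card * q.card))
  return (p.sort ×ˢ q.sort).map fun u => toColex (ofColex u.1 ∪ ofColex u.2)

/-- Addition of polynomials. -/
def addT (p q : BoolPoly n) : Timed (BoolPoly n) := do
  let zs ← mergeT p.sort q.sort
  return zs.toFinset

/-- Writing `p = I x_c + U`: one pass over the monomials of `p`. -/
def splitT (c : Fin n) (p : BoolPoly n) : Timed (BoolPoly n × BoolPoly n) := do
  tick (n * p.card)
  return (coeffPart c p, restPart c p)

/-- Substitution of `L` for `x_c` in `p = I x_c + U`: the computation of `I L + U`. -/
def substT (c : Fin n) (L p : BoolPoly n) : Timed (BoolPoly n) := do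
  let (I, U) ← splitT c p
  let ms ← productsT I L
  let s ← sumT ms
  let zs ← mergeT s U.sort
  return zs.toFinset

/-- The cost of putting `p` into a polynomial set or taking it out: one pass over its bits, which
also finds its class and its degree and whether it is constant, linear or monic. (The sets are
search trees keyed by these data followed by the bits of the polynomial; updating such a tree
leaves its older versions valid, so that a set need not be copied.) -/
def fileCost (p : BoolPoly n) : ℕ := n * p.card + 1

/-- The cost of putting all elements of `S` into a polynomial set. -/
def fileAllCost (S : PolySet n) : ℕ := ∑ p ∈ S, fileCost p

/-- Substitution of `L` for `x_c` in all elements of `S`. -/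
def substAllT (c : Fin n) (L : BoolPoly n) (S : PolySet n) : Timed (PolySet n) :=
  ⟨S.image fun p => (substT c L p).val,
    ∑ p ∈ S, (fileCost p + (substT c L p).cost + fileCost (substT c L p).val)⟩

end Polynomials

/-! ### The algorithm as a machine

The configurations are the control points of the algorithm, and `Step` lists its instructions with
their costs. Where the algorithm says "choose an element" (other than by `Choose`), every admissible
element gives a step. -/

/-- The variables of `TriSet`: the current system `𝒫`, the triangular set `𝒜`, the group `𝒫*` of
polynomial sets split off so far, and the counter `n_monic`. -/
structure State (n : ℕ) where
  sys : PolySet n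
  tri : PolySet n
  split : List (PolySet n)
  monics : ℕ

/-- The two places where `AddReduce` is called. -/
inductive Site
  | threshold
  | allMonic

/-- Control points. -/
inductive Config (n : ℕ)
  /-- The input. -/
  | start (F : PolySet n)
  /-- The head of the main loop `while 𝒫 ≠ ∅`. -/
  | loop (s : State n)
  /-- The head of the loop of `Simplify`, working on `s.sys`; `A` is its set of linear polynomials
  found so far. -/
  | simplify (s : State n) (A : PolySet n)
  /-- The test `n_monic ≥ t`. -/
  | test (s : State n)
  /-- The head of the loop of `AddReduce` over the classes: `todo` holds the input polynomials of
  the remaining classes and `done` is the output so far; `s.sys` is the part of `𝒫` which is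
  not an input of `AddReduce`. -/
  | addReduce (site : Site) (s : State n) (todo done : PolySet n)
  /-- The inner loop of `AddReduce`: `Q` is to be added to the polynomials in `rest`, which have
  the same class. -/
  | reduceClass (site : Site) (s : State n) (todo done : PolySet n) (Q : BoolPoly n)
      (rest : PolySet n)
  /-- The test whether all elements of `𝒫` are monic. -/
  | branch (s : State n)
  /-- The output: `𝒜` and `𝒫*`; after a contradiction `𝒜` is `∅`. -/
  | halt (A : PolySet n) (split : List (PolySet n))

/-- Where to continue after `AddReduce`. -/
def Site.next {n : ℕ} : Site → State n → Config n
  | .threshold, s => .branch s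
  | .allMonic, s => .loop s

/-- `Step choose t c k c'`: `TriSet` with the function `choose` and the threshold value `t` can pass
from `c` to `c'` by one instruction, which takes `k` bit operations. -/
inductive Step {n : ℕ} (choose : PolySet n → BoolPoly n) (t : ℕ) :
    Config n → ℕ → Config n → Prop
  | start (F : PolySet n) :
      Step choose t (.start F) (1 + fileAllCost F) (.loop ⟨F, ∅, [], (F.filter Monic).card⟩)
  -- the main loop
  | loop_exit (s : State n) (h : s.sys = ∅) :
      Step choose t (.loop s) 1 (.halt s.tri s.split)
  | loop_enter (s : State n) (h : s.sys ≠ ∅) :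
      Step choose t (.loop s) 1 (.simplify s ∅)
  -- `Simplify`
  | simplify_contradiction (s : State n) (A : PolySet n) (h : one ∈ s.sys) :
      Step choose t (.simplify s A) 1 (.halt ∅ s.split)
  | simplify_subst (s : State n) (A : PolySet n) (h : one ∉ s.sys)
      (p : BoolPoly n) (hp : p ∈ s.sys) (hlin : Linear p) (c : Fin n) (hc : cls p = c + 1) :
      Step choose t (.simplify s A)
        (1 + (splitT c p).cost + (substAllT c (restPart c p) (s.sys.erase p)).cost
          + 2 * fileCost p)
        (.simplify { s with sys := (substAllT c (restPart c p) (s.sys.erase p)).val }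
          (insert p A))
  | simplify_return (s : State n) (A : PolySet n) (h : one ∉ s.sys)
      (hlin : ∀ p ∈ s.sys, ¬ Linear p) :
      Step choose t (.simplify s A) (1 + fileAllCost A)
        (.test { s with sys := s.sys.erase ∅, tri := s.tri ∪ A })
  -- `AddReduce` for the monic polynomials once there are enough of them
  | test_yes (s : State n) (h : t ≤ s.monics) :
      Step choose t (.test s) 1
        (.addReduce .threshold { s with sys := s.sys.filter fun p => ¬ Monic p }
          (s.sys.filter Monic) ∅)
  | test_no (s : State n) (h : s.monics < t) :
      Step choose t (.test s) 1 (.branch s)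
  -- `AddReduce`
  | addReduce_return (site : Site) (s : State n) (done : PolySet n) :
      Step choose t (.addReduce site s ∅ done) (n + 1)
        (site.next { s with sys := s.sys ∪ done })
  | addReduce_class (site : Site) (s : State n) (todo done : PolySet n)
      (Q : BoolPoly n) (hQ : Q ∈ todo) (hmin : ∀ R ∈ todo, cls R = cls Q → tdeg Q ≤ tdeg R) :
      Step choose t (.addReduce site s todo done) (n + 1 + 2 * fileCost Q)
        (.reduceClass site s (todo.filter fun R => cls R ≠ cls Q) (insert Q done) Q
          ((todo.filter fun R => cls R = cls Q).erase Q))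
  | reduceClass_return (site : Site) (s : State n) (todo done : PolySet n) (Q : BoolPoly n) :
      Step choose t (.reduceClass site s todo done Q ∅) 1 (.addReduce site s todo done)
  | reduceClass_contradiction (site : Site) (s : State n) (todo done : PolySet n)
      (Q : BoolPoly n) (rest : PolySet n) (R : BoolPoly n) (hR : R ∈ rest)
      (h : (addT R Q).val = one) :
      Step choose t (.reduceClass site s todo done Q rest)
        (1 + fileCost R + (addT R Q).cost + fileCost (addT R Q).val) (.halt ∅ s.split)
  | reduceClass_add (site : Site) (s : State n) (todo done : PolySet n)
      (Q : BoolPoly n) (rest : PolySet n) (R : BoolPoly n) (hR : R ∈ rest)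
      (h : (addT R Q).val ≠ one) :
      Step choose t (.reduceClass site s todo done Q rest)
        (1 + fileCost R + (addT R Q).cost + fileCost (addT R Q).val)
        (.reduceClass site s todo
          (if (addT R Q).val = ∅ then done else insert (addT R Q).val done) Q (rest.erase R))
  -- all elements are monic
  | branch_triangular (s : State n) (h : ∀ p ∈ s.sys, Monic p)
      (hcls : Set.InjOn cls (s.sys : Set (BoolPoly n))) :
      Step choose t (.branch s) (n + 1 + fileAllCost s.sys) (.halt (s.tri ∪ s.sys) s.split)
  | branch_addReduce (s : State n) (h : ∀ p ∈ s.sys, Monic p)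
      (hcls : ¬ Set.InjOn cls (s.sys : Set (BoolPoly n))) :
      Step choose t (.branch s) (n + 1) (.addReduce .allMonic { s with sys := ∅ } s.sys ∅)
  -- zero decomposition of the chosen polynomial `p = I x_c + U`
  | branch_decompose (s : State n) (h : ∃ p ∈ s.sys, ¬ Monic p)
      (p I U : BoolPoly n) (hp : choose s.sys = p) (c : Fin n) (hc : cls p = c + 1)
      (hIU : (splitT c p).val = (I, U)) :
      Step choose t (.branch s)
        (n + 1 + fileCost p + (splitT c p).cost
          + (fileAllCost s.tri + fileCost I + fileCost U)
          + ((addT (var c) U).cost + fileCost (addT (var c) U).val)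
          + ((addT I one).cost + fileCost (addT I one).val))
        (.loop
          { s with
            sys := s.sys.erase p ∪ {(addT (var c) U).val} ∪ {(addT I one).val}
            split := (s.sys.erase p ∪ s.tri ∪ {I, U}) :: s.split
            monics := s.monics + 1 })

/-- A `Choose` function chooses a non-monic element from every polynomial set that has one. -/
def IsChoose {n : ℕ} (choose : PolySet n → BoolPoly n) : Prop :=
  ∀ S : PolySet n, (∃ p ∈ S, ¬ Monic p) → choose S ∈ S ∧ ¬ Monic (choose S)

/-- From `c` every execution halts with an output (none gets stuck or runs forever), and takes at
most `B` bit operations in total. -/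
inductive HaltsWithin {n : ℕ} (choose : PolySet n → BoolPoly n) (t : ℕ) : ℕ → Config n → Prop
  | halt (B : ℕ) (A : PolySet n) (split : List (PolySet n)) :
      HaltsWithin choose t B (.halt A split)
  | step (B : ℕ) (c : Config n)
      (progress : ∃ k c', Step choose t c k c')
      (budget : ∀ k c', Step choose t c k c' → k ≤ B)
      (next : ∀ k c', Step choose t c k c' → HaltsWithin choose t (B - k) c') :
      HaltsWithin choose t B c

end TriSet

namespace TriSet

variable {n : ℕ}

/-! ### Merging and sorting -/

/-! Termination and the bound both come from one potential that every instruction lowers by at least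
its cost. It has three parts: a multiple of the total weight of the current system, a multiple of
the number of variables in that system, and a reserve that depends on the control point.

The weight of a polynomial bounds its descendants. It is built from numbers W(k, c) for degree k and
class c with W(k+1, c+1) = (1 + W(k+1, c)) + W(k, c) + 1. A non-monic polynomial weighs W(k, c), a
monic one 1 + W(k, c-1). When P = I x_c + U is decomposed, x_c + U is monic of degree at most k and
class c, while I + 1 has both smaller degree and smaller class; by the recursion at least one unit
of weight is lost (`weight_decompose`). Adding a monic Q to a monic R of the same class and no
smaller degree cancels the leading variable without raising the degree of R, and again a unit is
lost (`weight_addT_lt`). Substituting a linear polynomial raises neither degree nor class, and a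
monic polynomial stays monic if its class survives; so no weight is gained (`weight_substT_le`).
Pascal's rule gives W(d, n) ≤ 3(n^d + 1), so the weight starts at O(m n^d). Each polynomial weighs
at least 1, hence the same number bounds the size of the system at all times.

Substitutions need not lower the weight, but each removes a variable from the whole system, so there
are at most n of them. A linear polynomial has at most n + 1 monomials, so one substitution into one
polynomial costs O(d n^(d+2) log n) by merge sort. The product m n^d · n · d n^(d+2) log n is the
dominant term. Apart from substitutions and additions a pass of the main loop costs O(n^(d+2) +
n^3), and a pass that leads to another one contains a decomposition or an addition, so the lost unit
of weight pays for the next pass. -/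

lemma mergeT_nil_left (ys : List (Mono n)) : mergeT [] ys = ⟨ys, n * ys.length⟩ := by
  rw [mergeT]; rfl

lemma mergeT_nil_right (x : Mono n) (xs : List (Mono n)) :
    mergeT (x :: xs) [] = ⟨x :: xs, n * (x :: xs).length⟩ := by
  rw [mergeT]; rfl

lemma mergeT_cons (x y : Mono n) (xs ys : List (Mono n)) :
    mergeT (x :: xs) (y :: ys) =
      if x = y then ⟨(mergeT xs ys).val, n + (mergeT xs ys).cost⟩
      else if x < y then
        ⟨x :: (mergeT xs (y :: ys)).val, n + (n + (mergeT xs (y :: ys)).cost)⟩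
      else ⟨y :: (mergeT (x :: xs) ys).val, n + (n + (mergeT (x :: xs) ys).cost)⟩ := by
  rw [mergeT]
  split_ifs <;> rfl

lemma mergeT_length_cost (xs ys : List (Mono n)) :
    (mergeT xs ys).val.length ≤ xs.length + ys.length ∧
      (mergeT xs ys).cost ≤ 2 * n * (xs.length + ys.length) := by
  induction xs, ys using mergeT.induct with
  | case1 ys => rw [mergeT_nil_left]; simp; nlinarith
  | case2 x xs => rw [mergeT_nil_right]; simp; nlinarith
  | case3 x xs y ys ih₁ ih₂ ih₃ =>
    by_cases h1 : x = y
    · subst h1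
      have ih := ih₁
      rw [mergeT_cons, if_pos rfl]
      simp only [List.length_cons]
      exact ⟨by omega, by nlinarith⟩
    by_cases h2 : x < y
    · have ih := ih₂
      rw [mergeT_cons, if_neg h1, if_pos h2]
      simp only [List.length_cons] at ih ⊢
      exact ⟨by omega, by nlinarith⟩
    · have ih := ih₃
      rw [mergeT_cons, if_neg h1, if_neg h2]
      simp only [List.length_cons] at ih ⊢
      exact ⟨by omega, by nlinarith⟩

lemma mem_or_mem_of_mem_mergeT {a : Mono n} (xs ys : List (Mono n)) :
    a ∈ (mergeT xs ys).val → a ∈ xs ∨ a ∈ ys := by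
  induction xs, ys using mergeT.induct with
  | case1 ys => rw [mergeT_nil_left]; simp
  | case2 x xs => rw [mergeT_nil_right]; simp
  | case3 x xs y ys ih₁ ih₂ ih₃ =>
    by_cases h1 : x = y
    · subst h1
      have ih := ih₁
      rw [mergeT_cons, if_pos rfl]
      simp only [List.mem_cons]
      clear ih₁ ih₂ ih₃
      tauto
    by_cases h2 : x < y
    · have ih := ih₂
      rw [mergeT_cons, if_neg h1, if_pos h2]
      simp only [List.mem_cons] at ih ⊢
      clear ih₁ ih₂ ih₃
      tauto
    · have ih := ih₃
      rw [mergeT_cons, if_neg h1, if_neg h2]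
      simp only [List.mem_cons] at ih ⊢
      clear ih₁ ih₂ ih₃
      tauto

lemma pairwise_mergeT (xs ys : List (Mono n)) (hx : xs.Pairwise (· < ·))
    (hy : ys.Pairwise (· < ·)) : (mergeT xs ys).val.Pairwise (· < ·) := by
  induction xs, ys using mergeT.induct with
  | case1 ys => rwa [mergeT_nil_left]
  | case2 x xs => rwa [mergeT_nil_right]
  | case3 x xs y ys ih₁ ih₂ ih₃ =>
    by_cases h1 : x = y
    · subst h1
      have ih := ih₁
      rw [mergeT_cons, if_pos rfl]
      exact ih hx.of_cons hy.of_cons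
    by_cases h2 : x < y
    · have ih := ih₂
      rw [mergeT_cons, if_neg h1, if_pos h2]
      refine List.pairwise_cons.2 ⟨fun a ha => ?_, ih hx.of_cons hy⟩
      rcases mem_or_mem_of_mem_mergeT _ _ ha with ha | ha
      · exact List.rel_of_pairwise_cons hx ha
      · rcases List.mem_cons.1 ha with rfl | ha
        · exact h2
        · exact h2.trans (List.rel_of_pairwise_cons hy ha)
    · have ih := ih₃
      rw [mergeT_cons, if_neg h1, if_neg h2]
      have h3 : y < x := lt_of_le_of_ne (not_lt.1 h2) (Ne.symm h1)
      refine List.pairwise_cons.2 ⟨fun a ha => ?_, ih hx hy.of_cons⟩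
      rcases mem_or_mem_of_mem_mergeT _ _ ha with ha | ha
      · rcases List.mem_cons.1 ha with rfl | ha
        · exact h3
        · exact h3.trans (List.rel_of_pairwise_cons hx ha)
      · exact List.rel_of_pairwise_cons hy ha

lemma notMem_of_forall_lt {x : Mono n} {xs : List (Mono n)} (h : ∀ a ∈ xs, x < a) : x ∉ xs :=
  fun hx => lt_irrefl _ (h x hx)

/-- Strict sortedness is essential: the smaller of two distinct heads cannot occur later in either
list, so every pair of equal monomials meets and cancels, and the result is the symmetric
difference. -/
lemma mem_mergeT {a : Mono n} (xs ys : List (Mono n)) (hx : xs.Pairwise (· < ·))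
    (hy : ys.Pairwise (· < ·)) : a ∈ (mergeT xs ys).val ↔ ¬ (a ∈ xs ↔ a ∈ ys) := by
  induction xs, ys using mergeT.induct with
  | case1 ys => rw [mergeT_nil_left]; simp
  | case2 x xs => rw [mergeT_nil_right]; simp only [List.not_mem_nil]; tauto
  | case3 x xs y ys ih₁ ih₂ ih₃ =>
    by_cases h1 : x = y
    · subst h1
      rw [mergeT_cons, if_pos rfl]
      have ih := ih₁ hx.of_cons hy.of_cons
      have h1 := notMem_of_forall_lt fun a => List.rel_of_pairwise_cons hx (a' := a)
      have h2 := notMem_of_forall_lt fun a => List.rel_of_pairwise_cons hy (a' := a)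
      simp only [List.mem_cons]
      by_cases hax : a = x
      · subst hax; simp only [ih, h1, h2]
      · simp only [hax, false_or]; exact ih
    by_cases h2 : x < y
    · rw [mergeT_cons, if_neg h1, if_pos h2]
      have ih := ih₂ hx.of_cons hy
      have h3 := notMem_of_forall_lt fun a => List.rel_of_pairwise_cons hx (a' := a)
      have h4 : x ∉ ys := notMem_of_forall_lt
        fun a ha => h2.trans (List.rel_of_pairwise_cons hy ha)
      simp only [List.mem_cons] at ih ⊢
      by_cases hax : a = x
      · subst hax; simp [h1, h4]
      · simp only [hax, false_or]; exact ih
    · rw [mergeT_cons, if_neg h1, if_neg h2]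
      have h3 : y < x := lt_of_le_of_ne (not_lt.1 h2) (Ne.symm h1)
      have ih := ih₃ hx hy.of_cons
      have h4 := notMem_of_forall_lt fun a => List.rel_of_pairwise_cons hy (a' := a)
      have h5 : y ∉ xs := notMem_of_forall_lt
        fun a ha => h3.trans (List.rel_of_pairwise_cons hx ha)
      simp only [List.mem_cons] at ih ⊢
      by_cases hax : a = y
      · subst hax; simp [Ne.symm h1, h5]
      · simp only [hax, false_or]; exact ih

lemma sumT_cons_cons (x y : Mono n) (l : List (Mono n)) :
    sumT (x :: y :: l) =
      ⟨(mergeT (sumT ((x :: y :: l).take ((l.length + 2) / 2))).val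
          (sumT ((x :: y :: l).drop ((l.length + 2) / 2))).val).val,
        n * (x :: y :: l).length + ((sumT ((x :: y :: l).take ((l.length + 2) / 2))).cost +
          ((sumT ((x :: y :: l).drop ((l.length + 2) / 2))).cost +
          (mergeT (sumT ((x :: y :: l).take ((l.length + 2) / 2))).val
            (sumT ((x :: y :: l).drop ((l.length + 2) / 2))).val).cost))⟩ := by
  rw [sumT]; rfl

/-- Only this containment is needed for sums of products: degree, class and variables are bounded
from above, so it never matters which products cancel. -/
lemma mem_of_mem_sumT {a : Mono n} (l : List (Mono n)) : a ∈ (sumT l).val → a ∈ l := by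
  induction l using sumT.induct with
  | case1 => rw [sumT]; exact id
  | case2 x => rw [sumT]; exact id
  | case3 x y l ih1 ih2 =>
    rw [sumT_cons_cons]
    intro h
    rcases mem_or_mem_of_mem_mergeT _ _ h with h | h
    · exact List.mem_of_mem_take (ih1 h)
    · exact List.mem_of_mem_drop (ih2 h)

lemma pairwise_sumT (l : List (Mono n)) : (sumT l).val.Pairwise (· < ·) := by
  induction l using sumT.induct with
  | case1 => rw [sumT]; exact List.Pairwise.nil
  | case2 x => rw [sumT]; exact List.pairwise_singleton _ _
  | case3 x y l ih1 ih2 =>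
    rw [sumT_cons_cons]
    exact pairwise_mergeT _ _ ih1 ih2

/-- Each level of the recursion spends n per entry on splitting and at most 2n per entry on merging,
whence the 3n; the depth is the rounded-up binary logarithm. -/
lemma sumT_length_cost (l : List (Mono n)) :
    (sumT l).val.length ≤ l.length ∧ (sumT l).cost ≤ 3 * n * l.length * Nat.clog 2 l.length := by
  induction l using sumT.induct with
  | case1 => rw [sumT]; exact ⟨le_rfl, Nat.zero_le _⟩
  | case2 x => rw [sumT]; exact ⟨le_rfl, Nat.zero_le _⟩
  | case3 x y l ih1 ih2 =>
    rw [sumT_cons_cons]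
    obtain ⟨h1, h2⟩ := ih1
    obtain ⟨h3, h4⟩ := ih2
    obtain ⟨h5, h6⟩ := mergeT_length_cost (sumT ((x :: y :: l).take ((l.length + 2) / 2))).val
          (sumT ((x :: y :: l).drop ((l.length + 2) / 2))).val
    have e1 : ((x :: y :: l).take ((l.length + 2) / 2)).length = (l.length + 2) / 2 := by
      rw [List.length_take, List.length_cons, List.length_cons]; omega
    have e2 : ((x :: y :: l).drop ((l.length + 2) / 2)).length
        = (l.length + 2) - (l.length + 2) / 2 := by
      rw [List.length_drop, List.length_cons, List.length_cons]
    rw [e1] at h1 h2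
    rw [e2] at h3 h4
    have e3 : (x :: y :: l).length = l.length + 2 := by simp
    rw [e3]
    set k := l.length + 2 with hk
    -- The larger half has ⌈k/2⌉ entries, so both recursive calls are bounded with one level fewer.
    have hc : Nat.clog 2 k = Nat.clog 2 ((k + 1) / 2) + 1 := by
      rw [Nat.clog_of_two_le one_lt_two (by omega)]; rfl
    have c1 : Nat.clog 2 (k / 2) ≤ Nat.clog 2 ((k + 1) / 2) :=
      Nat.clog_mono_right 2 (by omega)
    have c2 : Nat.clog 2 (k - k / 2) ≤ Nat.clog 2 ((k + 1) / 2) :=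
      Nat.clog_mono_right 2 (by omega)
    refine ⟨by simp only; omega, ?_⟩
    rw [hc]
    set q := Nat.clog 2 ((k + 1) / 2)
    have b1 := h2.trans (Nat.mul_le_mul_left (3 * n * (k / 2)) c1)
    have b2 := h4.trans (Nat.mul_le_mul_left (3 * n * (k - k / 2)) c2)
    have b3 := h6.trans (Nat.mul_le_mul_left (2 * n) (Nat.add_le_add h1 h3))
    have hs : k / 2 + (k - k / 2) = k := by omega
    rw [hs] at b3
    have b4 : 3 * n * (k / 2) * q + 3 * n * (k - k / 2) * q = 3 * n * k * q := by
      rw [← Nat.add_mul, ← Nat.mul_add, hs]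
    have b5 : 3 * n * k * (q + 1) = 3 * n * k * q + n * k + 2 * n * k := by ring
    rw [b5]
    simp only
    omega

/-! ### Sums, splitting and substitution -/

lemma addT_eq (p q : BoolPoly n) :
    addT p q = ⟨(mergeT p.sort q.sort).val.toFinset, (mergeT p.sort q.sort).cost⟩ := by
  rfl

lemma mem_addT {p q : BoolPoly n} {t : Mono n} :
    t ∈ (addT p q).val ↔ ¬ (t ∈ p ↔ t ∈ q) := by
  rw [addT_eq]
  simp only
  rw [List.mem_toFinset, mem_mergeT _ _ (Finset.sortedLT_sort p).pairwise
    (Finset.sortedLT_sort q).pairwise]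
  simp only [Finset.mem_sort]

lemma mem_or_mem_of_mem_addT {p q : BoolPoly n} {t : Mono n} (h : t ∈ (addT p q).val) :
    t ∈ p ∨ t ∈ q := by
  rw [mem_addT] at h; tauto

lemma cost_addT (p q : BoolPoly n) : (addT p q).cost ≤ 2 * n * (p.card + q.card) := by
  have := (mergeT_length_cost p.sort q.sort).2
  rw [Finset.length_sort, Finset.length_sort] at this
  rw [addT_eq]
  exact this

lemma mem_coeffPart {c : Fin n} {p : BoolPoly n} {t : Mono n} :
    t ∈ coeffPart c p ↔ ∃ u ∈ p, c ∈ ofColex u ∧ toColex ((ofColex u).erase c) = t := by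
  simp only [coeffPart, Finset.mem_image, Finset.mem_filter, and_assoc]

lemma mem_restPart {c : Fin n} {p : BoolPoly n} {t : Mono n} :
    t ∈ restPart c p ↔ t ∈ p ∧ c ∉ ofColex t := Finset.mem_filter

lemma card_coeffPart_le (c : Fin n) (p : BoolPoly n) : (coeffPart c p).card ≤ p.card :=
  Finset.card_image_le.trans (Finset.card_filter_le _ _)

lemma card_restPart_le (c : Fin n) (p : BoolPoly n) : (restPart c p).card ≤ p.card :=
  Finset.card_filter_le _ _

/-- The list of products that occurs in `substT`. -/
def productList (p q : BoolPoly n) : List (Mono n) :=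
  (p.sort ×ˢ q.sort).map fun u => toColex (ofColex u.1 ∪ ofColex u.2)

lemma mem_productList {p q : BoolPoly n} {t : Mono n} :
    t ∈ productList p q ↔ ∃ u ∈ p, ∃ v ∈ q, toColex (ofColex u ∪ ofColex v) = t := by
  simp [productList, List.mem_map, List.mem_product, and_assoc]

lemma length_productList (p q : BoolPoly n) : (productList p q).length = p.card * q.card := by
  rw [productList, List.length_map, List.length_product, Finset.length_sort, Finset.length_sort]

lemma substT_eq (c : Fin n) (L p : BoolPoly n) :
    substT c L p =
      ⟨(mergeT (sumT (productList (coeffPart c p) L)).val (restPart c p).sort).val.toFinset,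
        n * p.card + (n * ((coeffPart c p).card * L.card) +
          ((sumT (productList (coeffPart c p) L)).cost +
          (mergeT (sumT (productList (coeffPart c p) L)).val (restPart c p).sort).cost))⟩ := by
  rfl

lemma mem_substT {c : Fin n} {L p : BoolPoly n} {t : Mono n} :
    t ∈ (substT c L p).val ↔
      ¬ (t ∈ (sumT (productList (coeffPart c p) L)).val ↔ t ∈ restPart c p) := by
  rw [substT_eq]
  simp only
  rw [List.mem_toFinset, mem_mergeT _ _ (pairwise_sumT _)
    (Finset.sortedLT_sort _).pairwise, Finset.mem_sort]

lemma mem_substT_cases {c : Fin n} {L p : BoolPoly n} {t : Mono n}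
    (h : t ∈ (substT c L p).val) :
    (∃ u ∈ p, c ∈ ofColex u ∧ ∃ v ∈ L, ofColex t = (ofColex u).erase c ∪ ofColex v) ∨
      (t ∈ p ∧ c ∉ ofColex t) := by
  rw [mem_substT] at h
  by_cases ht : t ∈ restPart c p
  · exact Or.inr (mem_restPart.1 ht)
  · left
    have h1 : t ∈ productList (coeffPart c p) L := mem_of_mem_sumT _ (by tauto)
    obtain ⟨u, hu, v, hv, rfl⟩ := mem_productList.1 h1
    obtain ⟨w, hw, hc, rfl⟩ := mem_coeffPart.1 hu
    exact ⟨w, hw, hc, v, hv, rfl⟩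

/-- A monomial that is no product cannot be touched by cancellation, so its presence is decided by U
alone. This exactness is what preserves monicity under substitution. -/
lemma mem_substT_of_forall_ne {c : Fin n} {L p : BoolPoly n} {t : Mono n}
    (h : ∀ u ∈ p, c ∈ ofColex u → ∀ v ∈ L, ofColex t ≠ (ofColex u).erase c ∪ ofColex v) :
    t ∈ (substT c L p).val ↔ t ∈ p ∧ c ∉ ofColex t := by
  rw [mem_substT, ← mem_restPart]
  have h1 : t ∉ (sumT (productList (coeffPart c p) L)).val := by
    intro ht
    obtain ⟨u, hu, v, hv, rfl⟩ := mem_productList.1 (mem_of_mem_sumT _ ht)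
    obtain ⟨w, hw, hc, rfl⟩ := mem_coeffPart.1 hu
    exact h w hw hc v hv rfl
  tauto

lemma cost_substT_le {c : Fin n} {L p : BoolPoly n} {X Y : ℕ} (hp : p.card ≤ X)
    (hL : L.card ≤ Y) :
    (substT c L p).cost ≤
      n * X + n * (X * Y) + 3 * n * (X * Y) * Nat.clog 2 (X * Y) + 2 * n * (X * Y + X) := by
  rw [substT_eq]
  simp only
  have hI := (card_coeffPart_le c p).trans hp
  have hU := (card_restPart_le c p).trans hp
  have hIL := Nat.mul_le_mul hI hL
  obtain ⟨h1, h2⟩ := sumT_length_cost (productList (coeffPart c p) L)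
  obtain ⟨h3, h4⟩ := mergeT_length_cost (sumT (productList (coeffPart c p) L)).val
    (restPart c p).sort
  rw [length_productList] at h1 h2
  rw [Finset.length_sort] at h4
  have h5 : (sumT (productList (coeffPart c p) L)).cost ≤
      3 * n * (X * Y) * Nat.clog 2 (X * Y) :=
    h2.trans (Nat.mul_le_mul (Nat.mul_le_mul_left _ hIL) (Nat.clog_mono_right 2 hIL))
  have h6 := h4.trans (Nat.mul_le_mul_left (2 * n) (Nat.add_le_add (h1.trans hIL) hU))
  have h7 := Nat.mul_le_mul_left n hIL
  have h8 := Nat.mul_le_mul_left n hp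
  omega

/-! ### Degree, class and variables -/

lemma tdeg_le {p : BoolPoly n} {k : ℕ} : tdeg p ≤ k ↔ ∀ t ∈ p, (ofColex t).card ≤ k :=
  Finset.sup_le_iff

lemma cls_le {p : BoolPoly n} {k : ℕ} : cls p ≤ k ↔ ∀ t ∈ p, ∀ i ∈ ofColex t, (i : ℕ) + 1 ≤ k := by
  simp only [cls, Finset.sup_le_iff]

lemma cls_le_card (p : BoolPoly n) : cls p ≤ n :=
  cls_le.2 fun _ _ i _ => i.2

lemma card_le_tdeg {p : BoolPoly n} {t : Mono n} (h : t ∈ p) : (ofColex t).card ≤ tdeg p :=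
  tdeg_le.1 le_rfl t h

lemma lt_cls {p : BoolPoly n} {t : Mono n} {i : Fin n} (h : t ∈ p) (hi : i ∈ ofColex t) :
    (i : ℕ) + 1 ≤ cls p :=
  cls_le.1 le_rfl t h i hi

/-- The variables of a polynomial. -/
def pvars (p : BoolPoly n) : Finset (Fin n) := p.biUnion fun t => ofColex t

lemma mem_pvars {p : BoolPoly n} {i : Fin n} : i ∈ pvars p ↔ ∃ t ∈ p, i ∈ ofColex t :=
  Finset.mem_biUnion

lemma pvars_subset {p : BoolPoly n} {V : Finset (Fin n)} :
    pvars p ⊆ V ↔ ∀ t ∈ p, ofColex t ⊆ V := Finset.biUnion_subset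

lemma subset_pvars {p : BoolPoly n} {t : Mono n} (h : t ∈ p) : ofColex t ⊆ pvars p :=
  pvars_subset.1 subset_rfl t h

lemma exists_mem_of_cls_eq {p : BoolPoly n} {c : ℕ} (h : cls p = c + 1) :
    ∃ t ∈ p, ∃ i ∈ ofColex t, (i : ℕ) = c := by
  by_contra! hne
  have : cls p ≤ c := cls_le.2 fun t ht i hi => by
    have h1 := lt_cls ht hi
    have h2 := hne t ht i hi
    omega
  omega

lemma exists_mem_of_cls {p : BoolPoly n} {c : Fin n} (h : cls p = c + 1) :
    ∃ t ∈ p, c ∈ ofColex t := by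
  obtain ⟨t, ht, i, hi, hic⟩ := exists_mem_of_cls_eq h
  exact ⟨t, ht, Fin.ext hic ▸ hi⟩

lemma tdeg_pos {p : BoolPoly n} {c : Fin n} (h : cls p = c + 1) : 0 < tdeg p := by
  obtain ⟨t, ht, hc⟩ := exists_mem_of_cls h
  exact (Finset.card_pos.2 ⟨c, hc⟩).trans_le (card_le_tdeg ht)

lemma exists_cls_eq {p : BoolPoly n} (h : cls p ≠ 0) : ∃ c : Fin n, cls p = c + 1 := by
  have := cls_le_card p
  exact ⟨⟨cls p - 1, by omega⟩, by simp only; omega⟩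

lemma cls_ne_zero {p : BoolPoly n} (h0 : p ≠ ∅) (h1 : p ≠ one) : cls p ≠ 0 := by
  intro hc
  have h : ∀ t ∈ p, t = oneMono := fun t ht => by
    have : ofColex t = ∅ := Finset.eq_empty_of_forall_notMem fun i hi => by
      have := lt_cls ht hi
      omega
    exact congrArg toColex this
  exact (Finset.subset_singleton_iff.1 fun t ht => Finset.mem_singleton.2 (h t ht)).elim h0 h1

lemma ne_empty_of_cls {p : BoolPoly n} {c : Fin n} (h : cls p = c + 1) : p ≠ ∅ := by
  rintro rfl
  simp [cls] at h

lemma ne_one_of_cls {p : BoolPoly n} {c : Fin n} (h : cls p = c + 1) : p ≠ one := by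
  rintro rfl
  simp [cls, one, oneMono] at h

lemma cls_ne_zero_of_linear {p : BoolPoly n} (h : Linear p) : cls p ≠ 0 := by
  apply cls_ne_zero
  · rintro rfl
    simp [Linear, tdeg] at h
  · rintro rfl
    simp [Linear, tdeg, one, oneMono] at h

/-! ### The number of monomials of bounded degree -/

lemma sum_choose_le (n d : ℕ) : ∑ i ∈ Finset.range (d + 1), n.choose i ≤ n ^ d + 1 := by
  induction d with
  | zero => simp
  | succ d ih =>
    rw [Finset.sum_range_succ]
    -- For d ≥ 1 one has C(n, d+1) ≤ (d+1) C(n, d+1) = (n-d) C(n, d) ≤ (n-1) n^d, which leaves room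
    -- for n^d. For d = 0 this fails by one, but there the sum is computed directly.
    have key : n ^ d + n.choose (d + 1) ≤ n ^ (d + 1) + (if d = 0 then 1 else 0) := by
      rcases Nat.eq_zero_or_pos d with rfl | hd
      · simp [add_comm]
      · rw [if_neg hd.ne', add_zero, pow_succ]
        rcases Nat.eq_zero_or_pos n with rfl | hn
        · simp [hd.ne']
        · have h1 := Nat.choose_succ_right_eq n d
          have h2 : n.choose d ≤ n ^ d := Nat.choose_le_pow n d
          have h3 : n.choose (d + 1) ≤ n.choose (d + 1) * (d + 1) :=
            Nat.le_mul_of_pos_right _ d.succ_pos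
          have h4 : n.choose d * (n - d) ≤ n ^ d * (n - 1) :=
            Nat.mul_le_mul h2 (by omega)
          have h5 : n ^ d * (n - 1) + n ^ d = n ^ d * n := by
            rw [← Nat.mul_succ]; congr 1; omega
          omega
    rcases Nat.eq_zero_or_pos d with rfl | hd
    · simp; omega
    · rw [if_neg hd.ne'] at key
      omega

lemma card_le_of_tdeg_le {p : BoolPoly n} {d : ℕ} (h : tdeg p ≤ d) : p.card ≤ n ^ d + 1 := by
  have h1 : p ⊆ ((Finset.range (d + 1)).biUnion
      fun i => (Finset.univ : Finset (Fin n)).powersetCard i).image toColex := fun t ht => by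
    refine Finset.mem_image.2 ⟨ofColex t, Finset.mem_biUnion.2 ⟨(ofColex t).card, ?_, ?_⟩, rfl⟩
    · exact Finset.mem_range.2 (Nat.lt_succ_of_le (tdeg_le.1 h t ht))
    · exact Finset.mem_powersetCard.2 ⟨Finset.subset_univ _, rfl⟩
  refine (Finset.card_le_card h1).trans (Finset.card_image_le.trans
    (Finset.card_biUnion_le.trans ?_))
  simp only [Finset.card_powersetCard, Finset.card_univ, Fintype.card_fin]
  exact sum_choose_le n d

/-! ### Weights -/

/-- A bound for the number of polynomials that can descend from one of degree at most `k` and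
class at most `c`. -/
def weightBound : ℕ → ℕ → ℕ
  | 0, _ => 1
  | _ + 1, 0 => 1
  | k + 1, c + 1 => weightBound (k + 1) c + weightBound k c + 2

lemma weightBound_zero_right (k : ℕ) : weightBound k 0 = 1 := by
  cases k <;> simp [weightBound]

lemma one_le_weightBound (k c : ℕ) : 1 ≤ weightBound k c := by
  cases k <;> cases c <;> simp [weightBound]

lemma weightBound_mono_right (k : ℕ) : Monotone (weightBound k) := by
  refine monotone_nat_of_le_succ fun c => ?_
  cases k with
  | zero => simp [weightBound]
  | succ k => simp only [weightBound]; omega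

lemma weightBound_le_succ (k c : ℕ) : weightBound k c ≤ weightBound (k + 1) c := by
  induction c generalizing k with
  | zero => simp [weightBound_zero_right]
  | succ c ih =>
    cases k with
    | zero => exact one_le_weightBound 1 _
    | succ k =>
      have h1 := ih (k + 1)
      have h2 := ih k
      simp only [weightBound] at *
      omega

lemma weightBound_mono {k l c e : ℕ} (h : k ≤ l) (h' : c ≤ e) :
    weightBound k c ≤ weightBound l e :=
  (weightBound_mono_right k h').trans
    (monotone_nat_of_le_succ (f := fun k => weightBound k e) (fun k => weightBound_le_succ k e) h)

/-- Adding 2 turns the recursion into Pascal's rule f(k+1, c+1) = f(k+1, c) + f(k, c) with boundary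
value 3. Partial sums of binomial coefficients obey the same rule with boundary value 1. -/
lemma weightBound_add_two (k c : ℕ) :
    weightBound k c + 2 = 3 * ∑ i ∈ Finset.range (k + 1), c.choose i := by
  induction c generalizing k with
  | zero => simp [weightBound_zero_right, Finset.sum_range_succ']
  | succ c ih =>
    cases k with
    | zero => simp [weightBound]
    | succ k =>
      have h1 := ih (k + 1)
      have h2 := ih k
      rw [Finset.sum_range_succ'] at h1 ⊢
      simp only [Nat.choose_succ_succ', Finset.sum_add_distrib, Nat.choose_zero_right] at h1 ⊢
      simp only [weightBound]
      omega

lemma weightBound_le (d : ℕ) : weightBound d n ≤ 3 * (n ^ d + 1) := by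
  have h1 := weightBound_add_two d n
  have h2 := sum_choose_le n d
  omega

/-- The weight of a polynomial: it bounds the number of polynomials descending from it. -/
def weight (p : BoolPoly n) : ℕ :=
  if Monic p then 1 + weightBound (tdeg p) (cls p - 1) else weightBound (tdeg p) (cls p)

lemma Monic.weight_eq {p : BoolPoly n} {c : ℕ} (h : Monic p) (hc : cls p = c + 1) :
    weight p = 1 + weightBound (tdeg p) c := by
  rw [weight, if_pos h, hc, Nat.add_sub_cancel]

/-- In the monic case the claim is 1 + W(k, c) ≤ W(k, c+1), which holds by the recursion because a
positive class forces k > 0. -/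
lemma weight_le {p : BoolPoly n} {k c : ℕ} (hk : tdeg p ≤ k) (hc : cls p ≤ c) :
    weight p ≤ weightBound k c := by
  refine le_trans ?_ (weightBound_mono hk hc)
  by_cases h : Monic p
  · obtain ⟨i, hi, -⟩ := id h
    rw [h.weight_eq hi, hi]
    obtain ⟨l, hl⟩ := Nat.exists_eq_succ_of_ne_zero (tdeg_pos hi).ne'
    rw [hl]
    simp only [weightBound, Nat.succ_eq_add_one]
    omega
  · rw [weight, if_neg h]

lemma one_le_weight (p : BoolPoly n) : 1 ≤ weight p := by
  unfold weight
  split_ifs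
  · omega
  · exact one_le_weightBound _ _

/-! ### Monic polynomials -/

/-- The working form of monicity: the leading variable occurs in the single monomial x_c and in no
other. -/
lemma Monic.mem_iff {p : BoolPoly n} {c : Fin n} (h : Monic p) (hc : cls p = c + 1)
    {t : Mono n} (ht : c ∈ ofColex t) : t ∈ p ↔ t = toColex {c} := by
  obtain ⟨i, hi, h1⟩ := h
  obtain rfl : i = c := Fin.ext (by omega)
  constructor
  · intro htp
    have h2 : toColex ((ofColex t).erase i) ∈ coeffPart i p := mem_coeffPart.2 ⟨t, htp, ht, rfl⟩
    rw [h1, one, Finset.mem_singleton] at h2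
    have h3 : (ofColex t).erase i = ∅ := congrArg ofColex h2
    have h4 := Finset.insert_erase ht
    rw [h3] at h4
    exact (congrArg toColex h4).symm
  · rintro rfl
    have h2 : oneMono ∈ coeffPart i p := by rw [h1, one]; exact Finset.mem_singleton_self _
    obtain ⟨u, hu, hiu, h3⟩ := mem_coeffPart.1 h2
    have h4 : (ofColex u).erase i = ∅ := congrArg ofColex h3
    have h5 := Finset.insert_erase hiu
    rw [h4] at h5
    have h6 : u = toColex {i} := (congrArg toColex h5).symm
    rwa [← h6]

lemma monic_of_mem_iff {p : BoolPoly n} {c : Fin n} (hc : cls p = c + 1)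
    (h : ∀ t, c ∈ ofColex t → (t ∈ p ↔ t = toColex {c})) : Monic p := by
  refine ⟨c, hc, ?_⟩
  ext t
  rw [mem_coeffPart, one, Finset.mem_singleton]
  constructor
  · rintro ⟨u, hu, hcu, rfl⟩
    rw [(h u hcu).1 hu]
    simp [oneMono]
  · rintro rfl
    refine ⟨toColex {c}, (h _ (by simp)).2 rfl, by simp, by simp [oneMono]⟩

/-! ### Degree, class, variables and weight of the results of the operations -/

lemma tdeg_addT_le {p q : BoolPoly n} {k : ℕ} (hp : tdeg p ≤ k) (hq : tdeg q ≤ k) :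
    tdeg (addT p q).val ≤ k :=
  tdeg_le.2 fun t ht => (mem_or_mem_of_mem_addT ht).elim (tdeg_le.1 hp t) (tdeg_le.1 hq t)

lemma cls_addT_le {p q : BoolPoly n} {k : ℕ} (hp : cls p ≤ k) (hq : cls q ≤ k) :
    cls (addT p q).val ≤ k :=
  cls_le.2 fun t ht => (mem_or_mem_of_mem_addT ht).elim (cls_le.1 hp t) (cls_le.1 hq t)

lemma pvars_addT_subset {p q : BoolPoly n} {V : Finset (Fin n)} (hp : pvars p ⊆ V)
    (hq : pvars q ⊆ V) : pvars (addT p q).val ⊆ V :=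
  pvars_subset.2 fun t ht =>
    (mem_or_mem_of_mem_addT ht).elim (pvars_subset.1 hp t) (pvars_subset.1 hq t)

lemma cls_addT_lt {p q : BoolPoly n} {c : Fin n} (hp : Monic p) (hq : Monic q)
    (hpc : cls p = c + 1) (hqc : cls q = c + 1) : cls (addT p q).val ≤ c := by
  refine cls_le.2 fun t ht i hi => ?_
  have h1 : (i : ℕ) + 1 ≤ c + 1 :=
    (mem_or_mem_of_mem_addT ht).elim (fun h => hpc ▸ lt_cls h hi) (fun h => hqc ▸ lt_cls h hi)
  have h2 : i ≠ c := by
    rintro rfl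
    rw [mem_addT, hp.mem_iff hpc hi, hq.mem_iff hqc hi] at ht
    exact ht Iff.rfl
  have h3 : (i : ℕ) ≠ c := fun h => h2 (Fin.ext h)
  omega

/-- The two monomials x_c cancel, so the class drops. Since Q has minimal degree, the degree of R
does not grow, and the extra unit in the weight of the monic R is released. -/
lemma weight_addT_lt {p q : BoolPoly n} (hp : Monic p) (hq : Monic q)
    (hcls : cls p = cls q) (hdeg : tdeg q ≤ tdeg p) : weight (addT p q).val + 1 ≤ weight p := by
  obtain ⟨c, hc, -⟩ := id hp
  rw [hp.weight_eq hc]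
  have := weight_le (tdeg_addT_le le_rfl hdeg) (cls_addT_lt hp hq hc (hcls ▸ hc))
  omega

lemma tdeg_restPart_le (c : Fin n) (p : BoolPoly n) : tdeg (restPart c p) ≤ tdeg p :=
  tdeg_le.2 fun _ ht => card_le_tdeg (mem_restPart.1 ht).1

lemma pvars_restPart_subset (c : Fin n) (p : BoolPoly n) :
    pvars (restPart c p) ⊆ (pvars p).erase c :=
  pvars_subset.2 fun _ ht _ hi => Finset.mem_erase.2
    ⟨fun h => (mem_restPart.1 ht).2 (h ▸ hi), subset_pvars (mem_restPart.1 ht).1 hi⟩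

lemma cls_le_of_notMem_pvars {p q : BoolPoly n} {c : Fin n} (h : cls p = c + 1)
    (hq : pvars q ⊆ (pvars p).erase c) : cls q ≤ c := by
  refine cls_le.2 fun t ht i hi => ?_
  obtain ⟨h1, h2⟩ := Finset.mem_erase.1 (hq (subset_pvars ht hi))
  obtain ⟨u, hu, hiu⟩ := mem_pvars.1 h2
  have h3 := lt_cls hu hiu
  have h4 : (i : ℕ) ≠ c := fun h => h1 (Fin.ext h)
  omega

lemma pvars_coeffPart_subset (c : Fin n) (p : BoolPoly n) :
    pvars (coeffPart c p) ⊆ (pvars p).erase c := by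
  refine pvars_subset.2 fun t ht => ?_
  obtain ⟨u, hu, -, rfl⟩ := mem_coeffPart.1 ht
  exact Finset.erase_subset_erase c (subset_pvars hu)

lemma tdeg_coeffPart_le (c : Fin n) (p : BoolPoly n) : tdeg (coeffPart c p) ≤ tdeg p - 1 := by
  refine tdeg_le.2 fun t ht => ?_
  obtain ⟨u, hu, hc, rfl⟩ := mem_coeffPart.1 ht
  have := card_le_tdeg hu
  rw [ofColex_toColex, Finset.card_erase_of_mem hc]
  omega

lemma tdeg_one : tdeg (one : BoolPoly n) = 0 := by simp [tdeg, one, oneMono]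

lemma cls_one : cls (one : BoolPoly n) = 0 := by simp [cls, one, oneMono]

lemma pvars_one : pvars (one : BoolPoly n) = ∅ := by simp [pvars, one, oneMono]

lemma tdeg_var (c : Fin n) : tdeg (var c) = 1 := by simp [tdeg, var]

lemma cls_var (c : Fin n) : cls (var c) = c + 1 := by simp [cls, var]

lemma pvars_var (c : Fin n) : pvars (var c) = {c} := by simp [pvars, var]

lemma monic_addT_var {c : Fin n} {U : BoolPoly n} (h : cls U ≤ c) :
    Monic (addT (var c) U).val ∧ cls (addT (var c) U).val = c + 1 := by
  have h1 : ∀ t : Mono n, c ∈ ofColex t → (t ∈ (addT (var c) U).val ↔ t = toColex {c}) := by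
    intro t ht
    have h2 : t ∉ U := fun h3 => by
      have := lt_cls h3 ht
      omega
    rw [mem_addT, var, Finset.mem_singleton]
    tauto
  have h3 : cls (addT (var c) U).val = c + 1 := by
    refine le_antisymm (cls_addT_le (cls_var c).le (by omega)) ?_
    exact lt_cls ((h1 (toColex {c}) (by simp)).2 rfl) (by simp)
  exact ⟨monic_of_mem_iff h3 h1, h3⟩

/-- This is the recursion W(k+1, c+1) = (1 + W(k+1, c)) + W(k, c) + 1 read term by term: the monic
x_c + U, then I + 1 with degree and class reduced, then the unit that is gained. -/
lemma weight_decompose {p : BoolPoly n} {c : Fin n} (hp : ¬ Monic p) (hc : cls p = c + 1) :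
    weight (addT (var c) (restPart c p)).val + weight (addT (coeffPart c p) one).val + 1 ≤
      weight p := by
  have hU := cls_le_of_notMem_pvars hc (pvars_restPart_subset c p)
  have hI := cls_le_of_notMem_pvars hc (pvars_coeffPart_subset c p)
  have hk := tdeg_pos hc
  obtain ⟨hm, hmc⟩ := monic_addT_var hU
  have h1 : tdeg (addT (var c) (restPart c p)).val ≤ tdeg p :=
    tdeg_addT_le (by rw [tdeg_var]; exact hk) (tdeg_restPart_le c p)
  have h2 : weight (addT (coeffPart c p) one).val ≤ weightBound (tdeg p - 1) c :=
    weight_le (tdeg_addT_le (tdeg_coeffPart_le c p) (by rw [tdeg_one]; omega))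
      (cls_addT_le hI (by rw [cls_one]; omega))
  have h3 := weightBound_mono h1 (le_refl (c : ℕ))
  rw [hm.weight_eq hmc, weight.eq_1 p, if_neg hp, hc]
  obtain ⟨k, hk⟩ := Nat.exists_eq_succ_of_ne_zero hk.ne'
  rw [hk] at h2 h3 ⊢
  simp only [weightBound, Nat.succ_eq_add_one, Nat.add_sub_cancel] at *
  omega

lemma tdeg_substT_le {c : Fin n} {L p : BoolPoly n} (hL : tdeg L ≤ 1) :
    tdeg (substT c L p).val ≤ tdeg p := by
  refine tdeg_le.2 fun t ht => ?_
  rcases mem_substT_cases ht with ⟨u, hu, hc, v, hv, h⟩ | ⟨h, -⟩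
  · rw [h]
    have h1 := Finset.card_union_le ((ofColex u).erase c) (ofColex v)
    have h2 := Finset.card_erase_add_one hc
    have h3 := tdeg_le.1 hL v hv
    have h4 := card_le_tdeg hu
    omega
  · exact card_le_tdeg h

lemma pvars_substT_subset {c : Fin n} {L p : BoolPoly n} {V : Finset (Fin n)}
    (hL : pvars L ⊆ V.erase c) (hp : pvars p ⊆ V) : pvars (substT c L p).val ⊆ V.erase c := by
  refine pvars_subset.2 fun t ht => ?_
  rcases mem_substT_cases ht with ⟨u, hu, hc, v, hv, h⟩ | ⟨h, hc⟩
  · rw [h]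
    exact Finset.union_subset (Finset.erase_subset_erase c (pvars_subset.1 hp u hu))
      (pvars_subset.1 hL v hv)
  · exact fun i hi => Finset.mem_erase.2
      ⟨fun h' => hc (h' ▸ hi), pvars_subset.1 hp t h hi⟩

lemma cls_substT_le {c : Fin n} {L p : BoolPoly n} (hL : cls L ≤ c) :
    cls (substT c L p).val ≤ cls p := by
  refine cls_le.2 fun t ht i hi => ?_
  rcases mem_substT_cases ht with ⟨u, hu, hc, v, hv, h⟩ | ⟨h, -⟩
  · rw [h, Finset.mem_union] at hi
    rcases hi with hi | hi
    · exact lt_cls hu (Finset.mem_of_mem_erase hi)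
    · have h1 := lt_cls hv hi
      have h2 := lt_cls hu hc
      omega
  · exact lt_cls h hi

/-- The only danger is a monic polynomial turning non-monic in the same class. If its leading
variable is not the eliminated one and survives as the class, no product I L can contain it, so it
still occurs only in its own monomial. -/
lemma weight_substT_le {c : Fin n} {L p : BoolPoly n} (hL : tdeg L ≤ 1) (hLc : cls L ≤ c) :
    weight (substT c L p).val ≤ weight p := by
  have hdeg := tdeg_substT_le (c := c) (p := p) hL
  have hcls := cls_substT_le (p := p) hLc
  by_cases hp : Monic p
  · obtain ⟨e, he, -⟩ := id hp
    rw [hp.weight_eq he]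
    have hmem : ∀ t : Mono n, e ∈ ofColex t → e ≠ c →
        (t ∈ (substT c L p).val ↔ t = toColex {e}) := by
      intro t ht hec
      rw [mem_substT_of_forall_ne, ← hp.mem_iff he ht]
      · refine and_iff_left_of_imp fun h => ?_
        rw [hp.mem_iff he ht] at h
        rw [h]
        simpa using hec.symm
      -- A product containing x_e would come from a monomial with x_c and x_e together, impossible
      -- by monicity, or from a monomial of L with x_e, impossible since L has class below c < e.
      · intro u hu hcu v hv h
        rw [h, Finset.mem_union, Finset.mem_erase] at ht
        have hce : (c : ℕ) < e := by
          have := lt_cls hu hcu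
          have h1 : (e : ℕ) ≠ c := fun h => hec (Fin.ext h)
          omega
        rcases ht with ht | ht
        · rw [hp.mem_iff he ht.2] at hu
          rw [hu] at hcu
          simp at hcu
          exact hec hcu.symm
        · have := lt_cls hv ht
          omega
    by_cases hlt : cls (substT c L p).val ≤ e
    · exact (weight_le hdeg hlt).trans (by omega)
    · have hq : cls (substT c L p).val = e + 1 := by omega
      -- If x_e itself were eliminated it would not occur in the result, whose class could then not
      -- be e + 1.
      have hec : e ≠ c := by
        rintro rfl
        obtain ⟨t, ht, het⟩ := exists_mem_of_cls hq
        have := pvars_substT_subset (c := e) (L := L) (p := p) (V := Finset.univ)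
          (pvars_subset.2 fun v hv i hi => Finset.mem_erase.2 ⟨?_, Finset.mem_univ _⟩)
          (Finset.subset_univ _) (subset_pvars ht het)
        · simp at this
        · rintro rfl
          have := lt_cls hv hi
          omega
      rw [(monic_of_mem_iff hq fun t ht => hmem t ht hec).weight_eq hq]
      have := weightBound_mono hdeg (le_refl (e : ℕ))
      omega
  · rw [weight.eq_1 p, if_neg hp]
    exact weight_le hdeg hcls

/-! ### Bounds for the costs -/

/-- A bound for the number of monomials of a polynomial of degree at most `d`. -/
def monoBound (n d : ℕ) : ℕ := n ^ d + 1

/-- A bound for `fileCost` in degree at most `d`. -/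
def fileBound (n d : ℕ) : ℕ := (n + 1) * monoBound n d

/-- A bound for the cost from the control point `branch` to the next pass of the main loop. -/
def branchBound (n d : ℕ) : ℕ := (n + 1) ^ 3 + 20 * ((n + 1) * fileBound n d)

/-- A bound for the cost of a pass of the main loop without substitutions and additions. -/
def passBound (n d : ℕ) : ℕ := 2 * (n + 1) ^ 3 + 28 * ((n + 1) * fileBound n d)

/-- A bound for the cost of the elimination of a variable from one polynomial. -/
def substBound (n d : ℕ) : ℕ :=
  (n + 1) ^ 2 * monoBound n d * (8 + 3 * Nat.clog 2 (monoBound n d * (n + 1)))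

/-- A bound for the cost of the elimination of a variable from `M` polynomials. -/
def elimBound (n d M : ℕ) : ℕ := (M + 1) * substBound n d

lemma le_fileBound (n d : ℕ) : n + 1 ≤ fileBound n d :=
  Nat.le_mul_of_pos_right _ (Nat.succ_pos _)

lemma mul_monoBound_le (n d : ℕ) : n * monoBound n d + 1 ≤ fileBound n d := by
  have : 1 ≤ monoBound n d := Nat.succ_pos _
  unfold fileBound
  nlinarith

lemma fileBound_le (n d : ℕ) : fileBound n d ≤ (n + 1) * fileBound n d :=
  Nat.le_mul_of_pos_left _ (Nat.succ_pos _)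

lemma fileCost_le {p : BoolPoly n} {d : ℕ} (h : tdeg p ≤ d) : fileCost p ≤ fileBound n d :=
  le_trans (Nat.succ_le_succ (Nat.mul_le_mul_left n (card_le_of_tdeg_le h)))
    (mul_monoBound_le n d)

lemma mul_card_lt {p : BoolPoly n} {d : ℕ} (h : tdeg p ≤ d) : n * p.card + 1 ≤ fileBound n d :=
  fileCost_le h

lemma fileCost_le_of_tdeg_le_one {p : BoolPoly n} (h : tdeg p ≤ 1) :
    fileCost p ≤ (n + 1) ^ 2 := by
  refine (fileCost_le h).trans (le_of_eq ?_)
  simp only [fileBound, monoBound]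
  ring

lemma fileAllCost_le {S : PolySet n} {b : ℕ} (h : ∀ p ∈ S, fileCost p ≤ b) :
    fileAllCost S ≤ S.card * b := by
  rw [fileAllCost, ← smul_eq_mul]
  exact Finset.sum_le_card_nsmul S _ b h

lemma cost_addT_le {p q : BoolPoly n} {d : ℕ} (hp : tdeg p ≤ d) (hq : tdeg q ≤ d) :
    (addT p q).cost ≤ 4 * fileBound n d := by
  have h1 := cost_addT p q
  have h2 := mul_card_lt hp
  have h3 := mul_card_lt hq
  rw [mul_assoc, Nat.mul_add] at h1
  omega

lemma cost_substT_le_substBound {c : Fin n} {L p : BoolPoly n} {d : ℕ} (hp : tdeg p ≤ d)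
    (hL : tdeg L ≤ 1) :
    fileCost p + (substT c L p).cost + fileCost (substT c L p).val ≤ substBound n d := by
  have h1 := fileCost_le hp
  have h2 := fileCost_le ((tdeg_substT_le (c := c) hL).trans hp)
  have h3 : (substT c L p).cost ≤ _ :=
    -- A linear polynomial has at most n + 1 monomials: n variables and the constant.
    cost_substT_le (Y := n + 1) (card_le_of_tdeg_le hp)
      (by simpa using card_le_of_tdeg_le hL)
  change _ ≤ n * monoBound n d + n * (monoBound n d * (n + 1)) +
    3 * n * (monoBound n d * (n + 1)) * Nat.clog 2 (monoBound n d * (n + 1)) +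
    2 * n * (monoBound n d * (n + 1) + monoBound n d) at h3
  rw [fileBound] at h1 h2
  unfold substBound
  set l := Nat.clog 2 (monoBound n d * (n + 1))
  set X := monoBound n d
  have e1 : 3 * n * (X * (n + 1)) * l ≤ 3 * ((n + 1) ^ 2 * X * l) := by
    have : n * (n + 1) ≤ (n + 1) ^ 2 := by nlinarith
    calc 3 * n * (X * (n + 1)) * l = 3 * (n * (n + 1) * X * l) := by ring
      _ ≤ _ := by gcongr
  have e2 : n * X + n * (X * (n + 1)) + 2 * n * (X * (n + 1) + X) + 2 * ((n + 1) * X) ≤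
      8 * ((n + 1) ^ 2 * X) := by
    have : n + n * (n + 1) + 2 * n * (n + 1 + 1) + 2 * (n + 1) ≤ 8 * (n + 1) ^ 2 := by nlinarith
    calc _ = (n + n * (n + 1) + 2 * n * (n + 1 + 1) + 2 * (n + 1)) * X := by ring
      _ ≤ (8 * (n + 1) ^ 2) * X := Nat.mul_le_mul_right _ this
      _ = _ := by ring
  have e3 : (n + 1) ^ 2 * X * (8 + 3 * l) = 8 * ((n + 1) ^ 2 * X) + 3 * ((n + 1) ^ 2 * X * l) := by
    ring
  omega

/-- The summand 1 in the factor M + 1 of `elimBound` pays for moving and splitting the linear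
polynomial itself; this is the required comparison. -/
lemma four_mul_fileBound_le (n d : ℕ) : 4 * fileBound n d ≤ substBound n d := by
  have h1 : fileBound n d ≤ (n + 1) ^ 2 * monoBound n d := by
    rw [fileBound, pow_two, mul_assoc]
    exact Nat.le_mul_of_pos_left _ (Nat.succ_pos _)
  have h2 := Nat.mul_le_mul h1
    (show 4 ≤ 8 + 3 * Nat.clog 2 (monoBound n d * (n + 1)) by omega)
  rw [substBound]
  omega

/-! ### Weights and variables of polynomial sets -/

/-- The total weight of a polynomial set. -/
def totalWeight (S : PolySet n) : ℕ := ∑ p ∈ S, weight p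

/-- The variables of a polynomial set. -/
def vars (S : PolySet n) : Finset (Fin n) := S.biUnion pvars

lemma totalWeight_union_le (S T : PolySet n) :
    totalWeight (S ∪ T) ≤ totalWeight S + totalWeight T := by
  have := Finset.sum_union_inter (s₁ := S) (s₂ := T) (f := weight)
  simp only [totalWeight]
  omega

lemma totalWeight_insert_le (p : BoolPoly n) (S : PolySet n) :
    totalWeight (insert p S) ≤ weight p + totalWeight S := by
  have := totalWeight_union_le {p} S
  rw [Finset.insert_eq]
  simpa [totalWeight] using this

lemma totalWeight_erase_add {p : BoolPoly n} {S : PolySet n} (h : p ∈ S) :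
    totalWeight (S.erase p) + weight p = totalWeight S :=
  Finset.sum_erase_add S weight h

lemma totalWeight_mono {S T : PolySet n} (h : S ⊆ T) : totalWeight S ≤ totalWeight T :=
  Finset.sum_le_sum_of_subset h

lemma card_le_totalWeight (S : PolySet n) : S.card ≤ totalWeight S := by
  simpa [totalWeight] using Finset.card_nsmul_le_sum S weight 1 fun p _ => one_le_weight p

/-- Polynomials that become equal are counted once in the image, which only lowers the total. -/
lemma totalWeight_image_le {S : PolySet n} {f : BoolPoly n → BoolPoly n}
    (h : ∀ p ∈ S, weight (f p) ≤ weight p) : totalWeight (S.image f) ≤ totalWeight S := by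
  refine le_trans ?_ (Finset.sum_le_sum h)
  exact Finset.sum_image_le_of_nonneg (fun _ _ => Nat.zero_le _)

lemma pvars_subset_vars {p : BoolPoly n} {S : PolySet n} (h : p ∈ S) : pvars p ⊆ vars S :=
  Finset.subset_biUnion_of_mem pvars h

lemma vars_subset {S : PolySet n} {V : Finset (Fin n)} :
    vars S ⊆ V ↔ ∀ p ∈ S, pvars p ⊆ V := Finset.biUnion_subset

lemma card_image_cls_le (S : PolySet n) : (S.image cls).card ≤ n + 1 := by
  have : S.image cls ⊆ Finset.range (n + 1) := fun c hc => by
    obtain ⟨p, -, rfl⟩ := Finset.mem_image.1 hc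
    exact Finset.mem_range.2 (Nat.lt_succ_of_le (cls_le_card p))
  simpa using Finset.card_le_card this

/-! ### The invariant -/

/-- The facts about the polynomials in use: `S` are those of the system, of total weight `w`, and
`T` the linear ones that were put aside, `a` in number. -/
structure Tame (d M w a : ℕ) (S T : PolySet n) : Prop where
  tdeg_le : ∀ p ∈ S, tdeg p ≤ d
  weight_le : w ≤ M
  tdeg_le_one : ∀ p ∈ T, tdeg p ≤ 1
  card_le : a + (vars S).card ≤ n

lemma Tame.mono {d M w a w' a' : ℕ} {S T S' T' : PolySet n} (h : Tame d M w a S T)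
    (hw : w' ≤ w) (ha : a' ≤ a) (hT : T' ⊆ T)
    (hS : ∀ p ∈ S', tdeg p ≤ d ∧ pvars p ⊆ vars S) : Tame d M w' a' S' T' where
  tdeg_le p hp := (hS p hp).1
  weight_le := hw.trans h.weight_le
  tdeg_le_one p hp := h.tdeg_le_one p (hT hp)
  card_le := le_trans (Nat.add_le_add ha
    (Finset.card_le_card (vars_subset.2 fun p hp => (hS p hp).2))) h.card_le

lemma Tame.supp {d M w a : ℕ} {S T : PolySet n} (h : Tame d M w a S T) {p : BoolPoly n}
    (hp : p ∈ S) : tdeg p ≤ d ∧ pvars p ⊆ vars S :=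
  ⟨h.tdeg_le p hp, pvars_subset_vars hp⟩

lemma Tame.subset {d M w a w' a' : ℕ} {S T S' T' : PolySet n} (h : Tame d M w a S T)
    (hw : w' ≤ w) (ha : a' ≤ a) (hT : T' ⊆ T) (hS : S' ⊆ S) : Tame d M w' a' S' T' :=
  h.mono hw ha hT fun _ hp => h.supp (hS hp)

/-- No polynomial in the set is constant. -/
def NoConst (S : PolySet n) : Prop := ∀ p ∈ S, p ≠ ∅ ∧ p ≠ one

/-- The invariant of `TriSet`: all polynomials have degree at most `d`, the total weight of the
system is at most `M`, and every linear polynomial put aside has used up a variable. -/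
def Inv (d M : ℕ) : Config n → Prop
  | .start _ => False
  | .halt _ _ => True
  | .loop s => Tame d M (totalWeight s.sys) s.tri.card s.sys s.tri
  | .simplify s A => Tame d M (totalWeight s.sys) (s.tri.card + A.card) s.sys (s.tri ∪ A)
  | .test s => Tame d M (totalWeight s.sys) s.tri.card s.sys s.tri ∧ NoConst s.sys
  | .addReduce _ s todo done =>
      Tame d M (totalWeight s.sys + totalWeight todo + totalWeight done) s.tri.card
        (s.sys ∪ todo ∪ done) s.tri ∧ NoConst (s.sys ∪ done) ∧ ∀ p ∈ todo, Monic p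
  | .reduceClass _ s todo done Q rest =>
      Tame d M (totalWeight s.sys + totalWeight todo + totalWeight done + totalWeight rest)
        s.tri.card (s.sys ∪ todo ∪ done ∪ rest) s.tri ∧
      NoConst (s.sys ∪ done) ∧ (∀ p ∈ todo, Monic p) ∧ Q ∈ done ∧ Monic Q ∧
      ∀ R ∈ rest, Monic R ∧ cls R = cls Q ∧ tdeg Q ≤ tdeg R
  | .branch s => Tame d M (totalWeight s.sys) s.tri.card s.sys s.tri ∧ NoConst s.sys

/-! ### The potential -/

open Classical in
/-- The cost reserved for the time after a call of `AddReduce`; `pending` says that this call will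
still perform an addition. -/
noncomputable def afterReduce (n d : ℕ) (pending : Prop) : Site → ℕ
  | .threshold => branchBound n d
  | .allMonic => if pending then 7 * fileBound n d else passBound n d

/-- The potential: a bound for the cost of the executions from a configuration. -/
noncomputable def potential (d M : ℕ) : Config n → ℕ
  | .start _ => 0
  | .halt _ _ => 0
  | .loop s => passBound n d * totalWeight s.sys + elimBound n d M * (vars s.sys).card +
      passBound n d
  | .simplify s _ => passBound n d * totalWeight s.sys + elimBound n d M * (vars s.sys).card +
      (4 * ((n + 1) * fileBound n d) + n + 3 + branchBound n d + (n + 1) ^ 3)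
  | .test s => passBound n d * totalWeight s.sys + elimBound n d M * (vars s.sys).card +
      (4 * ((n + 1) * fileBound n d) + n + 2 + branchBound n d)
  | .addReduce site s todo done =>
      passBound n d * (totalWeight s.sys + totalWeight todo + totalWeight done) +
      elimBound n d M * (vars (s.sys ∪ todo ∪ done)).card +
      (4 * ((todo.image cls).card * fileBound n d) + n + 1 +
        afterReduce n d (¬ Set.InjOn cls (todo : Set (BoolPoly n))) site)
  | .reduceClass site s todo done _ rest =>
      passBound n d *
        (totalWeight s.sys + totalWeight todo + totalWeight done + totalWeight rest) +
      elimBound n d M * (vars (s.sys ∪ todo ∪ done ∪ rest)).card +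
      (4 * ((todo.image cls).card * fileBound n d) + n + 2 +
        afterReduce n d (rest.Nonempty ∨ ¬ Set.InjOn cls (todo : Set (BoolPoly n))) site)
  | .branch s => passBound n d * totalWeight s.sys + elimBound n d M * (vars s.sys).card +
      branchBound n d

/-! ### Every instruction decreases the potential by at least its cost -/

lemma potential_le {b e w w' : ℕ} {S S' : PolySet n} (hw : w' ≤ w)
    (hS : ∀ p ∈ S', pvars p ⊆ vars S) :
    b * w' + e * (vars S').card ≤ b * w + e * (vars S).card :=
  Nat.add_le_add (Nat.mul_le_mul_left b hw)
    (Nat.mul_le_mul_left e (Finset.card_le_card (vars_subset.2 hS)))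

/-- A lost unit of weight releases one full `passBound`. -/
lemma potential_add_le {b e w w' : ℕ} {S S' : PolySet n} (hw : w' + 1 ≤ w)
    (hS : ∀ p ∈ S', pvars p ⊆ vars S) :
    b * w' + e * (vars S').card + b ≤ b * w + e * (vars S).card := by
  have := potential_le (b := b) (e := e) hw hS
  rw [Nat.mul_succ] at this
  omega

section Steps

variable {d M : ℕ} {s : State n}

lemma loop_enter_spec (hs : Inv d M (.loop s)) :
    Inv d M (.simplify s ∅) ∧
      1 + potential d M (.simplify s ∅) ≤ potential d M (.loop s) := by
  refine ⟨Tame.subset hs le_rfl (by simp) (by simp) subset_rfl, ?_⟩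
  have h1 := le_fileBound n d
  have h2 := fileBound_le n d
  simp only [potential, branchBound, passBound]
  omega

/-- The eliminated variable disappears from every remaining polynomial, which releases one
`elimBound`. It also makes room in the invariant for the linear polynomial put aside. -/
lemma simplify_subst_spec {A : PolySet n} (hs : Inv d M (.simplify s A)) {p : BoolPoly n}
    (hp : p ∈ s.sys) (hlin : Linear p) {c : Fin n} (hc : cls p = c + 1) :
    Inv d M (.simplify { s with sys := (substAllT c (restPart c p) (s.sys.erase p)).val }
          (insert p A)) ∧
      (1 + (splitT c p).cost + (substAllT c (restPart c p) (s.sys.erase p)).cost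
          + 2 * fileCost p) +
        potential d M (.simplify
          { s with sys := (substAllT c (restPart c p) (s.sys.erase p)).val } (insert p A)) ≤
        potential d M (.simplify s A) := by
  have hs : Tame _ _ _ _ _ _ := hs
  have hd := hs.tdeg_le p hp
  have hL1 : tdeg (restPart c p) ≤ 1 := (tdeg_restPart_le c p).trans (le_of_eq hlin)
  have hLc := cls_le_of_notMem_pvars hc (pvars_restPart_subset c p)
  have hcv : c ∈ vars s.sys := by
    obtain ⟨t, ht, hct⟩ := exists_mem_of_cls hc
    exact pvars_subset_vars hp (subset_pvars ht hct)
  have hLv : pvars (restPart c p) ⊆ (vars s.sys).erase c :=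
    (pvars_restPart_subset c p).trans (Finset.erase_subset_erase c (pvars_subset_vars hp))
  have hmem : ∀ q ∈ (substAllT c (restPart c p) (s.sys.erase p)).val,
      tdeg q ≤ d ∧ pvars q ⊆ (vars s.sys).erase c := by
    intro q hq
    obtain ⟨r, hr, rfl⟩ := Finset.mem_image.1 hq
    have hr' := Finset.mem_of_mem_erase hr
    exact ⟨(tdeg_substT_le hL1).trans (hs.tdeg_le r hr'),
      pvars_substT_subset hLv (pvars_subset_vars hr')⟩
  have hw : totalWeight (substAllT c (restPart c p) (s.sys.erase p)).val ≤ totalWeight s.sys :=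
    (totalWeight_image_le fun q _ => weight_substT_le hL1 hLc).trans
      (totalWeight_mono (Finset.erase_subset _ _))
  have hv : (vars (substAllT c (restPart c p) (s.sys.erase p)).val).card + 1 ≤
      (vars s.sys).card := by
    rw [← Finset.card_erase_add_one hcv]
    exact Nat.succ_le_succ (Finset.card_le_card (vars_subset.2 fun q hq => (hmem q hq).2))
  have hcost : (substAllT c (restPart c p) (s.sys.erase p)).cost ≤ M * substBound n d := by
    have h1 : (substAllT c (restPart c p) (s.sys.erase p)).cost ≤
        (s.sys.erase p).card • substBound n d :=
      Finset.sum_le_card_nsmul _ _ _ fun q hq => cost_substT_le_substBound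
        (hs.tdeg_le q (Finset.mem_of_mem_erase hq)) hL1
    refine h1.trans (Nat.mul_le_mul_right _ ?_)
    exact (Finset.card_le_card (Finset.erase_subset _ _)).trans
      ((card_le_totalWeight _).trans hs.weight_le)
  constructor
  · refine ⟨fun q hq => (hmem q hq).1, hw.trans hs.weight_le, fun q hq => ?_, ?_⟩
    · rw [Finset.mem_union, Finset.mem_insert] at hq
      rcases hq with hq | rfl | hq
      · exact hs.tdeg_le_one q (Finset.mem_union_left _ hq)
      · exact le_of_eq hlin
      · exact hs.tdeg_le_one q (Finset.mem_union_right _ hq)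
    · have h1 := Finset.card_insert_le p A
      have h2 := hs.card_le
      simp only at *
      omega
  · have h1 := Nat.mul_le_mul_left (passBound n d) hw
    have h2 := Nat.mul_le_mul_left (elimBound n d M) hv
    have h3 := four_mul_fileBound_le n d
    have h4 : elimBound n d M = M * substBound n d + substBound n d := Nat.succ_mul _ _
    have h5 := fileCost_le hd
    have h6 := mul_card_lt hd
    have h7 : (splitT c p).cost = n * p.card := rfl
    have h8 := le_fileBound n d
    rw [Nat.mul_succ] at h2
    simp only [potential]
    omega

lemma simplify_return_spec {A : PolySet n} (hs : Inv d M (.simplify s A)) (h1 : one ∉ s.sys) :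
    Inv d M (.test { s with sys := s.sys.erase ∅, tri := s.tri ∪ A }) ∧
      (1 + fileAllCost A) +
        potential d M (.test { s with sys := s.sys.erase ∅, tri := s.tri ∪ A }) ≤
        potential d M (.simplify s A) := by
  have hs : Tame _ _ _ _ _ _ := hs
  have hw : totalWeight (s.sys.erase ∅) ≤ totalWeight s.sys :=
    totalWeight_mono (Finset.erase_subset _ _)
  refine ⟨⟨hs.subset hw (Finset.card_union_le _ _) subset_rfl (Finset.erase_subset _ _), ?_⟩, ?_⟩
  · intro p hp
    obtain ⟨hp0, hp⟩ := Finset.mem_erase.1 hp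
    exact ⟨hp0, fun h => h1 (h ▸ hp)⟩
  · have h2 := potential_le (b := passBound n d) (e := elimBound n d M) hw
      (S := s.sys) (S' := s.sys.erase ∅)
      fun p hp => pvars_subset_vars (Finset.mem_of_mem_erase hp)
    have h3 : fileAllCost A ≤ A.card * (n + 1) ^ 2 := fileAllCost_le fun p hp =>
      fileCost_le_of_tdeg_le_one (hs.tdeg_le_one p (Finset.mem_union_right _ hp))
    -- There are at most n linear polynomials put aside, since each has used up a variable.
    have h4 : A.card * (n + 1) ^ 2 ≤ (n + 1) ^ 3 := by
      rw [pow_succ' (n + 1) 2]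
      exact Nat.mul_le_mul_right _ (by have := hs.card_le; omega)
    simp only [potential]
    omega

lemma test_yes_spec (hs : Inv d M (.test s)) :
    Inv d M (.addReduce .threshold { s with sys := s.sys.filter fun p => ¬ Monic p }
          (s.sys.filter Monic) ∅) ∧
      1 + potential d M (.addReduce .threshold
          { s with sys := s.sys.filter fun p => ¬ Monic p } (s.sys.filter Monic) ∅) ≤
        potential d M (.test s) := by
  obtain ⟨hs, hnc⟩ := hs
  have hw : totalWeight (s.sys.filter fun p => ¬ Monic p) + totalWeight (s.sys.filter Monic) +
      totalWeight (∅ : PolySet n) = totalWeight s.sys := by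
    have := Finset.sum_filter_add_sum_filter_not s.sys Monic weight
    simp only [totalWeight, Finset.sum_empty, add_zero]
    rw [add_comm]
    exact this
  have hS : (s.sys.filter fun p => ¬ Monic p) ∪ s.sys.filter Monic ∪ ∅ ⊆ s.sys := by
    rw [Finset.union_empty]
    exact Finset.union_subset (Finset.filter_subset _ _) (Finset.filter_subset _ _)
  refine ⟨⟨hs.subset hw.le le_rfl subset_rfl hS, ?_, ?_⟩, ?_⟩
  · intro p hp
    rw [Finset.union_empty] at hp
    exact hnc p (Finset.mem_of_mem_filter p hp)
  · exact fun p hp => (Finset.mem_filter.1 hp).2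
  · have h2 := potential_le (b := passBound n d) (e := elimBound n d M) hw.le
      (S := s.sys) fun p hp => pvars_subset_vars (hS hp)
    have h3 := Nat.mul_le_mul_right (fileBound n d) (card_image_cls_le (s.sys.filter Monic))
    simp only [potential, afterReduce]
    omega

lemma test_no_spec (hs : Inv d M (.test s)) :
    Inv d M (.branch s) ∧ 1 + potential d M (.branch s) ≤ potential d M (.test s) := by
  refine ⟨hs, ?_⟩
  simp only [potential]
  omega

/-- With no input left nothing is pending, so the reserve is exactly what the next control point
demands. -/
lemma addReduce_return_spec {site : Site} {done : PolySet n}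
    (hs : Inv d M (.addReduce site s ∅ done)) :
    Inv d M (site.next { s with sys := s.sys ∪ done }) ∧
      (n + 1) + potential d M (site.next { s with sys := s.sys ∪ done }) ≤
        potential d M (.addReduce site s ∅ done) := by
  obtain ⟨hs, hnc, -⟩ := hs
  have hw : totalWeight (s.sys ∪ done) ≤
      totalWeight s.sys + totalWeight (∅ : PolySet n) + totalWeight done := by
    simpa [totalWeight] using totalWeight_union_le s.sys done
  have hS : s.sys ∪ done ⊆ s.sys ∪ ∅ ∪ done := by simp
  have ht := hs.subset hw le_rfl subset_rfl hS
  have h2 := potential_le (b := passBound n d) (e := elimBound n d M) hw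
    fun p hp => pvars_subset_vars (hS hp)
  cases site with
  | threshold =>
    refine ⟨⟨ht, hnc⟩, ?_⟩
    simp only [potential, afterReduce, Site.next]
    omega
  | allMonic =>
    refine ⟨ht, ?_⟩
    have h3 : ¬ ¬ Set.InjOn cls ((∅ : PolySet n) : Set (BoolPoly n)) := by simp
    simp only [potential, afterReduce, Site.next, if_neg h3]
    omega

lemma afterReduce_congr {p q : Prop} (h : p ↔ q) (site : Site) :
    afterReduce n d p site = afterReduce n d q site := by
  rw [propext h]

/-- Taking out a whole class does not change whether an addition is still to come: a repeated class
is either the one taken out or one of those left. -/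
lemma pending_iff {todo : PolySet n} {Q : BoolPoly n} (hQ : Q ∈ todo) :
    (((todo.filter fun R => cls R = cls Q).erase Q).Nonempty ∨
      ¬ Set.InjOn cls ((todo.filter fun R => cls R ≠ cls Q : PolySet n) : Set (BoolPoly n))) ↔
      ¬ Set.InjOn cls (todo : Set (BoolPoly n)) := by
  constructor
  · rintro (⟨R, hR⟩ | h) hinj
    · obtain ⟨hne, hR⟩ := Finset.mem_erase.1 hR
      obtain ⟨hR, hcls⟩ := Finset.mem_filter.1 hR
      exact hne (hinj hR hQ hcls)
    · exact h (hinj.mono (Finset.coe_subset.2 (Finset.filter_subset _ _)))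
  · intro h
    by_contra! hcon
    obtain ⟨h1, h2⟩ := hcon
    refine h fun R hR S hS hRS => ?_
    have hall : ∀ R ∈ todo, cls R = cls Q → R = Q := fun R hR hc => by
      by_contra hne
      have : R ∈ ((todo.filter fun R => cls R = cls Q).erase Q) :=
        Finset.mem_erase.2 ⟨hne, Finset.mem_filter.2 ⟨hR, hc⟩⟩
      rw [h1] at this
      exact Finset.notMem_empty R this
    by_cases hc : cls R = cls Q
    · rw [hall R hR hc, hall S hS (hRS ▸ hc)]
    · exact h2 (Finset.mem_coe.2 (Finset.mem_filter.2 ⟨hR, hc⟩))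
        (Finset.mem_coe.2 (Finset.mem_filter.2 ⟨hS, hRS ▸ hc⟩)) hRS

lemma addReduce_class_spec {site : Site} {todo done : PolySet n}
    (hs : Inv d M (.addReduce site s todo done)) {Q : BoolPoly n} (hQ : Q ∈ todo)
    (hmin : ∀ R ∈ todo, cls R = cls Q → tdeg Q ≤ tdeg R) :
    Inv d M (.reduceClass site s (todo.filter fun R => cls R ≠ cls Q) (insert Q done) Q
          ((todo.filter fun R => cls R = cls Q).erase Q)) ∧
      (n + 1 + 2 * fileCost Q) +
        potential d M (.reduceClass site s (todo.filter fun R => cls R ≠ cls Q) (insert Q done) Q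
          ((todo.filter fun R => cls R = cls Q).erase Q)) ≤
        potential d M (.addReduce site s todo done) := by
  obtain ⟨hs, hnc, hm⟩ := hs
  have hmQ := hm Q hQ
  have hw : totalWeight s.sys + totalWeight (todo.filter fun R => cls R ≠ cls Q) +
      totalWeight (insert Q done) + totalWeight ((todo.filter fun R => cls R = cls Q).erase Q) ≤
      totalWeight s.sys + totalWeight todo + totalWeight done := by
    have h1 := totalWeight_insert_le Q done
    have h2 := totalWeight_erase_add (S := todo.filter fun R => cls R = cls Q) (p := Q)
      (Finset.mem_filter.2 ⟨hQ, rfl⟩)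
    have h3 : totalWeight (todo.filter fun R => cls R = cls Q) +
        totalWeight (todo.filter fun R => cls R ≠ cls Q) = totalWeight todo :=
      Finset.sum_filter_add_sum_filter_not todo (fun R => cls R = cls Q) weight
    omega
  have hS : s.sys ∪ (todo.filter fun R => cls R ≠ cls Q) ∪ insert Q done ∪
      ((todo.filter fun R => cls R = cls Q).erase Q) ⊆ s.sys ∪ todo ∪ done := by
    intro p hp
    simp only [Finset.mem_union, Finset.mem_filter, Finset.mem_insert, Finset.mem_erase] at hp ⊢
    rcases hp with ((hp | hp) | rfl | hp) | hp
    · exact Or.inl (Or.inl hp)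
    · exact Or.inl (Or.inr hp.1)
    · exact Or.inl (Or.inr hQ)
    · exact Or.inr hp
    · exact Or.inl (Or.inr hp.2.1)
  have hQd : tdeg Q ≤ d :=
    hs.tdeg_le Q (Finset.mem_union_left _ (Finset.mem_union_right _ hQ))
  refine ⟨⟨hs.subset hw le_rfl subset_rfl hS, ?_, fun p hp => hm p (Finset.mem_of_mem_filter p hp),
    Finset.mem_insert_self _ _, hmQ, ?_⟩, ?_⟩
  · intro p hp
    rw [Finset.union_insert, Finset.mem_insert] at hp
    rcases hp with rfl | hp
    · obtain ⟨c, hc, -⟩ := hmQ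
      exact ⟨ne_empty_of_cls hc, ne_one_of_cls hc⟩
    · exact hnc p hp
  · intro R hR
    obtain ⟨hR, hc⟩ := Finset.mem_filter.1 (Finset.mem_of_mem_erase hR)
    exact ⟨hm R hR, hc, hmin R hR hc⟩
  · have h1 := potential_le (b := passBound n d) (e := elimBound n d M) hw
      fun p hp => pvars_subset_vars (hS hp)
    -- The class of Q is finished, so the reserve for one class is released; it covers filing Q and
    -- the control steps.
    have h2 : ((todo.filter fun R => cls R ≠ cls Q).image cls).card + 1 ≤
        (todo.image cls).card := by
      rw [← Finset.card_erase_add_one (Finset.mem_image_of_mem cls hQ)]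
      refine Nat.succ_le_succ (Finset.card_le_card fun c hc => ?_)
      obtain ⟨R, hR, rfl⟩ := Finset.mem_image.1 hc
      obtain ⟨hR, hne⟩ := Finset.mem_filter.1 hR
      exact Finset.mem_erase.2 ⟨hne, Finset.mem_image_of_mem cls hR⟩
    have h3 := Nat.mul_le_mul_right (fileBound n d) h2
    rw [Nat.succ_mul] at h3
    have h4 := fileCost_le hQd
    have h5 := le_fileBound n d
    simp only [potential]
    rw [afterReduce_congr (pending_iff hQ)]
    omega

lemma reduceClass_return_spec {site : Site} {todo done : PolySet n} {Q : BoolPoly n}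
    (hs : Inv d M (.reduceClass site s todo done Q ∅)) :
    Inv d M (.addReduce site s todo done) ∧
      1 + potential d M (.addReduce site s todo done) ≤
        potential d M (.reduceClass site s todo done Q ∅) := by
  obtain ⟨hs, hnc, hm, -⟩ := hs
  have hS : s.sys ∪ todo ∪ done ⊆ s.sys ∪ todo ∪ done ∪ ∅ := by simp
  have hw := Nat.le_add_right (totalWeight s.sys + totalWeight todo + totalWeight done)
    (totalWeight (∅ : PolySet n))
  refine ⟨⟨hs.subset hw le_rfl subset_rfl hS, hnc, hm⟩, ?_⟩
  have h1 := potential_le (b := passBound n d) (e := elimBound n d M) hw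
    fun p hp => pvars_subset_vars (hS hp)
  have h2 : ((∅ : PolySet n).Nonempty ∨ ¬ Set.InjOn cls (todo : Set (BoolPoly n))) ↔
      ¬ Set.InjOn cls (todo : Set (BoolPoly n)) := by simp
  simp only [potential]
  rw [afterReduce_congr h2]
  omega

lemma cost_reduce_le {R Q : BoolPoly n} (hR : tdeg R ≤ d) (hQ : tdeg Q ≤ d) :
    1 + fileCost R + (addT R Q).cost + fileCost (addT R Q).val ≤ 7 * fileBound n d := by
  have h1 := fileCost_le hR
  have h2 := cost_addT_le hR hQ
  have h3 := fileCost_le (tdeg_addT_le hR hQ)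
  have h4 := le_fileBound n d
  omega

lemma reduceClass_add_spec {site : Site} {todo done rest : PolySet n} {Q R : BoolPoly n}
    (hs : Inv d M (.reduceClass site s todo done Q rest)) (hR : R ∈ rest)
    (h : (addT R Q).val ≠ one) :
    Inv d M (.reduceClass site s todo
          (if (addT R Q).val = ∅ then done else insert (addT R Q).val done) Q (rest.erase R)) ∧
      (1 + fileCost R + (addT R Q).cost + fileCost (addT R Q).val) +
        potential d M (.reduceClass site s todo
          (if (addT R Q).val = ∅ then done else insert (addT R Q).val done) Q (rest.erase R)) ≤
        potential d M (.reduceClass site s todo done Q rest) := by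
  obtain ⟨hs, hnc, hm, hQ, hmQ, hrest⟩ := hs
  obtain ⟨hmR, hcR, hdR⟩ := hrest R hR
  have sR := hs.supp (Finset.mem_union_right (s.sys ∪ todo ∪ done) hR)
  have sQ := hs.supp
    (Finset.mem_union_left rest (Finset.mem_union_right (s.sys ∪ todo) hQ))
  set done' := if (addT R Q).val = ∅ then done else insert (addT R Q).val done with hdone
  have hsub : done ⊆ done' := by
    rw [hdone]
    split_ifs
    · exact subset_rfl
    · exact Finset.subset_insert _ _
  have hmem : ∀ p ∈ done', p ∈ done ∨ (p = (addT R Q).val ∧ p ≠ ∅) := by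
    intro p hp
    rw [hdone] at hp
    split_ifs at hp with h0
    · exact Or.inl hp
    · rcases Finset.mem_insert.1 hp with rfl | hp
      · exact Or.inr ⟨rfl, h0⟩
      · exact Or.inl hp
  have hw : totalWeight s.sys + totalWeight todo + totalWeight done' + totalWeight (rest.erase R)
      + 1 ≤ totalWeight s.sys + totalWeight todo + totalWeight done + totalWeight rest := by
    have h1 := totalWeight_erase_add hR
    have h2 := weight_addT_lt hmR hmQ hcR hdR
    have h3 : totalWeight done' ≤ weight (addT R Q).val + totalWeight done := by
      rw [hdone]
      split_ifs
      · omega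
      · exact totalWeight_insert_le _ _
    omega
  have hS : ∀ p ∈ s.sys ∪ todo ∪ done' ∪ rest.erase R,
      tdeg p ≤ d ∧ pvars p ⊆ vars (s.sys ∪ todo ∪ done ∪ rest) := by
    intro p hp
    simp only [Finset.mem_union] at hp
    rcases hp with ((hp | hp) | hp) | hp
    · exact hs.supp (by simp [hp])
    · exact hs.supp (by simp [hp])
    · rcases hmem p hp with hp | ⟨rfl, -⟩
      · exact hs.supp (by simp [hp])
      · exact ⟨tdeg_addT_le sR.1 sQ.1, pvars_addT_subset sR.2 sQ.2⟩
    · exact hs.supp (by simp [Finset.mem_of_mem_erase hp])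
  refine ⟨⟨hs.mono (by omega) le_rfl subset_rfl hS, ?_, hm, hsub hQ, hmQ,
    fun p hp => hrest p (Finset.mem_of_mem_erase hp)⟩, ?_⟩
  · intro p hp
    rcases Finset.mem_union.1 hp with hp | hp
    · exact hnc p (Finset.mem_union_left _ hp)
    · rcases hmem p hp with hp | ⟨rfl, h0⟩
      · exact hnc p (Finset.mem_union_right _ hp)
      · exact ⟨h0, h⟩
  · have h1 := potential_add_le (b := passBound n d) (e := elimBound n d M) hw
      fun p hp => (hS p hp).2
    have h2 := cost_reduce_le sR.1 sQ.1
    have h3 : 7 * fileBound n d ≤ passBound n d := by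
      have := fileBound_le n d
      unfold passBound
      omega
    have h4 : rest.Nonempty ∨ ¬ Set.InjOn cls (todo : Set (BoolPoly n)) := Or.inl ⟨R, hR⟩
    simp only [potential]
    cases site with
    | threshold =>
      simp only [afterReduce]
      omega
    | allMonic =>
      simp only [afterReduce, if_pos h4]
      -- If this was the last addition, the reserve must grow from `7 * fileBound n d` to `passBound
      -- n d`. The old reserve pays for the addition and the released unit of weight provides the
      -- new one.
      split_ifs <;> omega

/-- The cost is met from the reserve alone: this is why even a pending call keeps `7 * fileBound n
d`. -/
lemma reduceClass_contradiction_spec {site : Site} {todo done rest : PolySet n}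
    {Q R : BoolPoly n} (hs : Inv d M (.reduceClass site s todo done Q rest)) (hR : R ∈ rest) :
    1 + fileCost R + (addT R Q).cost + fileCost (addT R Q).val ≤
      potential d M (.reduceClass site s todo done Q rest) := by
  obtain ⟨hs, hnc, hm, hQ, hmQ, hrest⟩ := hs
  have h1 := cost_reduce_le (hs.tdeg_le R (Finset.mem_union_right (s.sys ∪ todo ∪ done) hR))
    (hs.tdeg_le Q (Finset.mem_union_left rest (Finset.mem_union_right (s.sys ∪ todo) hQ)))
  have h2 : 7 * fileBound n d ≤ afterReduce n d
      (rest.Nonempty ∨ ¬ Set.InjOn cls (todo : Set (BoolPoly n))) site := by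
    have := fileBound_le n d
    cases site with
    | threshold => simp only [afterReduce, branchBound]; omega
    | allMonic =>
      simp only [afterReduce, passBound]
      split_ifs <;> omega
  simp only [potential]
  omega

/-- Distinct classes limit the output to n + 1 polynomials, so filing it does not depend on the size
M of intermediate systems. -/
lemma branch_triangular_spec (hs : Inv d M (.branch s))
    (hcls : Set.InjOn cls (s.sys : Set (BoolPoly n))) :
    n + 1 + fileAllCost s.sys ≤ potential d M (.branch s) := by
  have h1 : fileAllCost s.sys ≤ s.sys.card * fileBound n d :=
    fileAllCost_le fun p hp => fileCost_le (hs.1.tdeg_le p hp)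
  have h2 := card_image_cls_le s.sys
  rw [Finset.card_image_of_injOn hcls] at h2
  have h3 := Nat.mul_le_mul_right (fileBound n d) h2
  have h4 := le_fileBound n d
  have h5 := fileBound_le n d
  simp only [potential, branchBound]
  omega

/-- A repeated class guarantees an addition, so the reserve for the next pass need not be available
yet; the addition will supply it from the weight. -/
lemma branch_addReduce_spec (hs : Inv d M (.branch s)) (h : ∀ p ∈ s.sys, Monic p)
    (hcls : ¬ Set.InjOn cls (s.sys : Set (BoolPoly n))) :
    Inv d M (.addReduce .allMonic { s with sys := ∅ } s.sys ∅) ∧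
      (n + 1) + potential d M (.addReduce .allMonic { s with sys := ∅ } s.sys ∅) ≤
        potential d M (.branch s) := by
  obtain ⟨hs, -⟩ := hs
  have hw : totalWeight (∅ : PolySet n) + totalWeight s.sys + totalWeight (∅ : PolySet n) ≤
      totalWeight s.sys := by simp [totalWeight]
  have hS : ∅ ∪ s.sys ∪ ∅ ⊆ s.sys := by simp
  refine ⟨⟨hs.subset hw le_rfl subset_rfl hS, by simp [NoConst], h⟩, ?_⟩
  have h1 := potential_le (b := passBound n d) (e := elimBound n d M) hw
    fun p hp => pvars_subset_vars (hS hp)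
  have h3 := Nat.mul_le_mul_right (fileBound n d) (card_image_cls_le s.sys)
  have h4 := le_fileBound n d
  have h5 := fileBound_le n d
  simp only [potential, branchBound, afterReduce, if_pos hcls]
  omega

/-- `branchBound` pays for the step, with its cubic term covering the copy of the at most n linear
polynomials into the split system; the lost unit of weight supplies the reserve of the next pass. -/
lemma branch_decompose_spec (hs : Inv d M (.branch s)) {p : BoolPoly n} (hp : p ∈ s.sys)
    (hm : ¬ Monic p) {c : Fin n} (hc : cls p = c + 1) (L : List (PolySet n)) (m : ℕ) :
    Inv d M (.loop ⟨s.sys.erase p ∪ {(addT (var c) (restPart c p)).val} ∪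
        {(addT (coeffPart c p) one).val}, s.tri, L, m⟩) ∧
      (n + 1 + fileCost p + (splitT c p).cost
          + (fileAllCost s.tri + fileCost (coeffPart c p) + fileCost (restPart c p))
          + ((addT (var c) (restPart c p)).cost + fileCost (addT (var c) (restPart c p)).val)
          + ((addT (coeffPart c p) one).cost + fileCost (addT (coeffPart c p) one).val)) +
        potential d M (.loop ⟨s.sys.erase p ∪ {(addT (var c) (restPart c p)).val} ∪
          {(addT (coeffPart c p) one).val}, s.tri, L, m⟩) ≤
        potential d M (.branch s) := by
  obtain ⟨hs, -⟩ := hs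
  obtain ⟨hpd, hpv⟩ := hs.supp hp
  have hd := (tdeg_pos hc).trans_le hpd
  have hU : tdeg (restPart c p) ≤ d := (tdeg_restPart_le c p).trans hpd
  have hI : tdeg (coeffPart c p) ≤ d := (tdeg_coeffPart_le c p).trans (by omega)
  have hx : tdeg (var c) ≤ d := by rw [tdeg_var]; exact hd
  have h1 : tdeg (one : BoolPoly n) ≤ d := by rw [tdeg_one]; omega
  have hxU := tdeg_addT_le hx hU
  have hI1 := tdeg_addT_le hI h1
  have hcv : c ∈ pvars p := by
    obtain ⟨t, ht, hct⟩ := exists_mem_of_cls hc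
    exact subset_pvars ht hct
  have hw : totalWeight (s.sys.erase p ∪ {(addT (var c) (restPart c p)).val} ∪
      {(addT (coeffPart c p) one).val}) + 1 ≤ totalWeight s.sys := by
    have h1 := totalWeight_union_le (s.sys.erase p ∪ {(addT (var c) (restPart c p)).val})
      {(addT (coeffPart c p) one).val}
    have h2 := totalWeight_union_le (s.sys.erase p) {(addT (var c) (restPart c p)).val}
    have h3 := totalWeight_erase_add hp
    have h4 := weight_decompose hm hc
    have h5 : ∀ q : BoolPoly n, totalWeight {q} = weight q := fun q => Finset.sum_singleton _ _
    rw [h5] at h1 h2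
    omega
  have hS : ∀ q ∈ s.sys.erase p ∪ {(addT (var c) (restPart c p)).val} ∪
      {(addT (coeffPart c p) one).val}, tdeg q ≤ d ∧ pvars q ⊆ vars s.sys := by
    intro q hq
    simp only [Finset.mem_union, Finset.mem_singleton] at hq
    rcases hq with (hq | rfl) | rfl
    · exact hs.supp (Finset.mem_of_mem_erase hq)
    · refine ⟨hxU, (pvars_addT_subset ?_ ?_).trans hpv⟩
      · rw [pvars_var]
        exact Finset.singleton_subset_iff.2 hcv
      · exact (pvars_restPart_subset c p).trans (Finset.erase_subset _ _)
    · refine ⟨hI1, (pvars_addT_subset ?_ ?_).trans hpv⟩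
      · exact (pvars_coeffPart_subset c p).trans (Finset.erase_subset _ _)
      · rw [pvars_one]
        exact Finset.empty_subset _
  refine ⟨hs.mono (Nat.le_of_succ_le hw) le_rfl subset_rfl hS, ?_⟩
  have k1 := potential_add_le (b := passBound n d) (e := elimBound n d M) hw
    fun q hq => (hS q hq).2
  have k2 := fileCost_le hpd
  have k3 : (splitT c p).cost = n * p.card := rfl
  have k4 := mul_card_lt hpd
  have k5 : fileAllCost s.tri ≤ s.tri.card * (n + 1) ^ 2 := fileAllCost_le fun p hp =>
    fileCost_le_of_tdeg_le_one (hs.tdeg_le_one p hp)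
  have k6 : s.tri.card * (n + 1) ^ 2 ≤ (n + 1) ^ 3 := by
    rw [pow_succ' (n + 1) 2]
    exact Nat.mul_le_mul_right _ (by have := hs.card_le; omega)
  have k7 := fileCost_le hU
  have k8 := fileCost_le hI
  have k9 := fileCost_le hxU
  have k10 := fileCost_le hI1
  have k11 := cost_addT_le hx hU
  have k12 := cost_addT_le hI h1
  have k13 := le_fileBound n d
  have k14 := fileBound_le n d
  simp only [potential, branchBound]
  omega

end Steps

/-- The lower bound on the cost of a step is there for termination: no infinite execution can have
bounded total cost. -/
theorem Step.spec {d M t k : ℕ} {choose : PolySet n → BoolPoly n} (hch : IsChoose choose)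
    {c c' : Config n} (h : Step choose t c k c') (hc : Inv d M c) :
    Inv d M c' ∧ 1 ≤ k ∧ k + potential d M c' ≤ potential d M c := by
  have hpos : 1 ≤ passBound n d := by
    have : 0 < (n + 1) ^ 3 := Nat.pow_pos n.succ_pos
    unfold passBound
    omega
  cases h with
  | start F => exact hc.elim
  | loop_exit s h => exact ⟨trivial, le_rfl, by simp only [potential]; omega⟩
  | loop_enter s h => exact ⟨(loop_enter_spec hc).1, le_rfl, (loop_enter_spec hc).2⟩
  | simplify_contradiction s A h => exact ⟨trivial, le_rfl, by simp only [potential]; omega⟩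
  | simplify_subst s A h p hp hlin c hcls =>
    have := simplify_subst_spec hc hp hlin hcls
    exact ⟨this.1, by omega, this.2⟩
  | simplify_return s A h hlin =>
    have := simplify_return_spec hc h
    exact ⟨this.1, by omega, this.2⟩
  | test_yes s h => exact ⟨(test_yes_spec hc).1, le_rfl, (test_yes_spec hc).2⟩
  | test_no s h => exact ⟨(test_no_spec hc).1, le_rfl, (test_no_spec hc).2⟩
  | addReduce_return site s done =>
    have := addReduce_return_spec hc
    exact ⟨this.1, by omega, this.2⟩
  | addReduce_class site s todo done Q hQ hmin =>
    have := addReduce_class_spec hc hQ hmin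
    exact ⟨this.1, by omega, this.2⟩
  | reduceClass_return site s todo done Q =>
    have := reduceClass_return_spec hc
    exact ⟨this.1, by omega, this.2⟩
  | reduceClass_contradiction site s todo done Q rest R hR h =>
    exact ⟨trivial, by omega, reduceClass_contradiction_spec hc hR⟩
  | reduceClass_add site s todo done Q rest R hR h =>
    have := reduceClass_add_spec hc hR h
    exact ⟨this.1, by omega, this.2⟩
  | branch_triangular s h hcls =>
    exact ⟨trivial, by omega, branch_triangular_spec hc hcls⟩
  | branch_addReduce s h hcls =>
    have := branch_addReduce_spec hc h hcls
    exact ⟨this.1, by omega, this.2⟩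
  | branch_decompose s h p I U hp c hcls hIU =>
    obtain ⟨rfl, rfl⟩ := Prod.mk.inj hIU
    obtain ⟨h1, h2⟩ := hch s.sys h
    rw [hp] at h1 h2
    have := branch_decompose_spec hc h1 h2 hcls
      ((s.sys.erase p ∪ s.tri ∪ {coeffPart c p, restPart c p}) :: s.split) (s.monics + 1)
    exact ⟨this.1, by omega, this.2⟩

theorem Inv.progress {d M t : ℕ} {choose : PolySet n → BoolPoly n} (hch : IsChoose choose)
    {c : Config n} (hc : Inv d M c) :
    (∃ A L, c = .halt A L) ∨ ∃ k c', Step choose t c k c' := by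
  cases c with
  | start F => exact hc.elim
  | halt A L => exact Or.inl ⟨A, L, rfl⟩
  | loop s =>
    right
    by_cases h : s.sys = ∅
    · exact ⟨_, _, Step.loop_exit s h⟩
    · exact ⟨_, _, Step.loop_enter s h⟩
  | simplify s A =>
    right
    by_cases h : one ∈ s.sys
    · exact ⟨_, _, Step.simplify_contradiction s A h⟩
    · by_cases hl : ∀ p ∈ s.sys, ¬ Linear p
      · exact ⟨_, _, Step.simplify_return s A h hl⟩
      · push Not at hl
        obtain ⟨p, hp, hlin⟩ := hl
        obtain ⟨c, hc⟩ := exists_cls_eq (cls_ne_zero_of_linear hlin)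
        exact ⟨_, _, Step.simplify_subst s A h p hp hlin c hc⟩
  | test s =>
    right
    rcases le_or_gt t s.monics with h | h
    · exact ⟨_, _, Step.test_yes s h⟩
    · exact ⟨_, _, Step.test_no s h⟩
  | addReduce site s todo done =>
    right
    rcases Finset.eq_empty_or_nonempty todo with rfl | ⟨P, hP⟩
    · exact ⟨_, _, Step.addReduce_return site s done⟩
    · obtain ⟨Q, hQ, hmin⟩ := Finset.exists_min_image todo tdeg ⟨P, hP⟩
      exact ⟨_, _, Step.addReduce_class site s todo done Q hQ fun R hR _ => hmin R hR⟩
  | reduceClass site s todo done Q rest =>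
    right
    rcases Finset.eq_empty_or_nonempty rest with rfl | ⟨R, hR⟩
    · exact ⟨_, _, Step.reduceClass_return site s todo done Q⟩
    · by_cases h : (addT R Q).val = one
      · exact ⟨_, _, Step.reduceClass_contradiction site s todo done Q rest R hR h⟩
      · exact ⟨_, _, Step.reduceClass_add site s todo done Q rest R hR h⟩
  | branch s =>
    right
    by_cases h : ∀ p ∈ s.sys, Monic p
    · by_cases hcls : Set.InjOn cls (s.sys : Set (BoolPoly n))
      · exact ⟨_, _, Step.branch_triangular s h hcls⟩
      · exact ⟨_, _, Step.branch_addReduce s h hcls⟩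
    · push Not at h
      -- The chosen polynomial is not constant, so it has a leading variable; this is why the
      -- invariant carries `NoConst` up to this control point.
      have h1 := hc.2 _ (hch s.sys h).1
      obtain ⟨c, hcls⟩ := exists_cls_eq (cls_ne_zero h1.1 h1.2)
      exact ⟨_, _, Step.branch_decompose s h _ _ _ rfl c hcls rfl⟩

/-- Induction on the budget suffices, because every step uses up at least one unit of it. -/
theorem haltsWithin_of_inv {d M t : ℕ} {choose : PolySet n → BoolPoly n} (hch : IsChoose choose)
    (B : ℕ) (c : Config n) (hc : Inv d M c) (hB : potential d M c ≤ B) :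
    HaltsWithin choose t B c := by
  induction B using Nat.strong_induction_on generalizing c with
  | _ B ih =>
    rcases hc.progress (t := t) hch with ⟨A, L, rfl⟩ | hstep
    · exact .halt B A L
    · refine .step B c hstep (fun k c' h => ?_) fun k c' h => ?_
      · have := h.spec hch hc
        omega
      · obtain ⟨h1, h2, h3⟩ := h.spec hch hc
        exact ih (B - k) (by omega) c' h1 (by omega)

/-! ### The bound -/

/-- An explicit bound, per input polynomial, for the bit-size complexity of `TriSet`. -/
def complexityBound (n d : ℕ) : ℕ :=
  154 * ((n + 1) ^ 3 * monoBound n d ^ 2 * (Nat.clog 2 (monoBound n d * (n + 1)) + 1))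

theorem haltsWithin_start {d m t : ℕ} {choose : PolySet n → BoolPoly n} (hch : IsChoose choose)
    {F : PolySet n} (hm : 1 ≤ m) (hF : F.card = m) (hd : ∀ f ∈ F, tdeg f ≤ d) :
    HaltsWithin choose t (m * complexityBound n d) (.start F) := by
  -- The m input polynomials weigh at most W(d, n) ≤ 3(n^d + 1) each.
  set M := 3 * (m * monoBound n d) with hM
  have hw : totalWeight F ≤ M := by
    have h1 := Finset.sum_le_card_nsmul F weight (3 * monoBound n d) fun f hf =>
      (weight_le (hd f hf) (cls_le_card f)).trans (weightBound_le d)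
    rw [hF, smul_eq_mul] at h1
    refine h1.trans (le_of_eq ?_)
    rw [hM]
    ring
  have hv : (vars F).card ≤ n := by simpa using Finset.card_le_univ (vars F)
  have hinv : ∀ L k, Inv d M (.loop ⟨F, ∅, L, k⟩) := fun L k =>
    ⟨hd, hw, by simp, by simpa using hv⟩
  have hcost : fileAllCost F ≤ m * fileBound n d :=
    hF ▸ fileAllCost_le fun f hf => fileCost_le (hd f hf)
  have hpot : ∀ L k, 1 + fileAllCost F + potential d M (.loop ⟨F, ∅, L, k⟩) ≤
      m * complexityBound n d := by
    intro L k
    simp only [potential]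
    have h1 := Nat.mul_le_mul_left (passBound n d) hw
    have h2 := Nat.mul_le_mul_left (elimBound n d M) hv
    refine (Nat.add_le_add (Nat.add_le_add_left hcost 1)
      (Nat.add_le_add_right (Nat.add_le_add h1 h2) _)).trans ?_
    rw [hM]
    simp only [complexityBound, elimBound, passBound, substBound, fileBound]
    set l := Nat.clog 2 (monoBound n d * (n + 1))
    have hX : 1 ≤ monoBound n d := Nat.succ_pos _
    set X := monoBound n d
    obtain ⟨x, hx⟩ : ∃ x, X = x + 1 := ⟨X - 1, by omega⟩
    obtain ⟨u, rfl⟩ : ∃ u, m = u + 1 := ⟨m - 1, by omega⟩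
    have hmX : 1 ≤ (u + 1) * X := Nat.mul_pos hm hX
    set y := n + 1 with hy
    have hy1 : 1 ≤ y := Nat.succ_pos n
    have hn : n ≤ y := Nat.le_succ n
    have e0 : y ≤ y ^ 3 := Nat.le_self_pow (by norm_num) y
    have eX : X ≤ X ^ 2 := Nat.le_self_pow (by norm_num) X
    have e1 : 2 * y ^ 3 + 28 * (y * (y * X)) ≤ 30 * (y ^ 3 * X) := by
      have i1 : y ^ 3 ≤ y ^ 3 * X := Nat.le_mul_of_pos_right _ hX
      have i2 : y * (y * X) ≤ y ^ 3 * X := by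
        calc y * (y * X) = y ^ 2 * X := by ring
          _ ≤ y ^ 3 * X := by gcongr; norm_num
      omega
    -- This bounds the passes, `e3` the eliminations and `e4` the input; 120 + 32 + 2 is the
    -- constant 154.
    have e2 : (2 * y ^ 3 + 28 * (y * (y * X))) * (3 * ((u + 1) * X)) +
        (2 * y ^ 3 + 28 * (y * (y * X))) ≤ 120 * ((u + 1) * (y ^ 3 * X ^ 2)) := by
      calc _ = (2 * y ^ 3 + 28 * (y * (y * X))) * (3 * ((u + 1) * X) + 1) := by ring
        _ ≤ 30 * (y ^ 3 * X) * (4 * ((u + 1) * X)) := Nat.mul_le_mul e1 (by omega)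
        _ = _ := by ring
    have e3 : (3 * ((u + 1) * X) + 1) * (y ^ 2 * X * (8 + 3 * l)) * n ≤
        32 * ((u + 1) * (y ^ 3 * X ^ 2 * (l + 1))) := by
      calc _ ≤ (4 * ((u + 1) * X)) * (y ^ 2 * X * (8 * (l + 1))) * y := by
            gcongr <;> omega
        _ = _ := by ring
    have e4 : 1 + (u + 1) * (y * X) ≤ 2 * ((u + 1) * (y ^ 3 * X ^ 2)) := by
      have i1 : y * X ≤ y ^ 3 * X ^ 2 := Nat.mul_le_mul e0 eX
      have i2 := Nat.mul_le_mul_left (u + 1) i1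
      have i3 : 1 ≤ (u + 1) * (y * X) := Nat.mul_pos hm (Nat.mul_pos hy1 hX)
      omega
    have e5 : (u + 1) * (y ^ 3 * X ^ 2) ≤ (u + 1) * (y ^ 3 * X ^ 2 * (l + 1)) :=
      Nat.mul_le_mul_left _ (Nat.le_mul_of_pos_right _ l.succ_pos)
    have e6 : (u + 1) * (154 * (y ^ 3 * X ^ 2 * (l + 1))) =
        154 * ((u + 1) * (y ^ 3 * X ^ 2 * (l + 1))) := by ring
    omega
  refine .step _ _ ⟨_, _, Step.start F⟩ (fun k c' h => ?_) fun k c' h => ?_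
  · cases h
    exact (Nat.le_add_right _ _).trans (hpot [] (F.filter Monic).card)
  · cases h
    have := hpot [] (F.filter Monic).card
    exact haltsWithin_of_inv hch _ _ (hinv _ _) (by omega)

lemma complexityBound_le {n d : ℕ} (hn : 2 ≤ n) (hd : 1 ≤ d) :
    (complexityBound n d : ℝ) ≤ 100000 * (d * (n : ℝ) ^ (2 * d + 3) * Real.log n) := by
  have hn' : (2 : ℝ) ≤ n := by exact_mod_cast hn
  have hd' : (1 : ℝ) ≤ d := by exact_mod_cast hd
  have hlog2 : 0.5 < Real.log 2 := by linarith [Real.log_two_gt_d9]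
  have hlog : Real.log 2 ≤ Real.log n := Real.log_le_log (by norm_num) hn'
  have hX : (monoBound n d : ℝ) ≤ 2 * (n : ℝ) ^ d := by
    have : (1 : ℝ) ≤ (n : ℝ) ^ d := one_le_pow₀ (by linarith)
    simp only [monoBound]
    push_cast
    linarith
  have hl : (Nat.clog 2 (monoBound n d * (n + 1)) : ℝ) + 1 ≤ 16 * (d * Real.log n) := by
    have h1 : monoBound n d * (n + 1) ≤ 4 * n ^ (d + 1) := by
      have h2 : 1 ≤ n ^ d := Nat.one_le_pow _ _ (by omega)
      calc monoBound n d * (n + 1) ≤ (2 * n ^ d) * (2 * n) :=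
            Nat.mul_le_mul (by unfold monoBound; omega) (by omega)
        _ = _ := by ring
    have h2 := Nat.clog_mono_right 2 h1
    have h3 : (Nat.clog 2 (4 * n ^ (d + 1)) : ℝ) ≤ Real.logb 2 (4 * (n : ℝ) ^ (d + 1)) + 1 := by
      have h4 := Real.ceil_logb_natCast (b := 2) (r := 4 * (n : ℝ) ^ (d + 1)) (by positivity)
      have h5 : Int.clog 2 (4 * (n : ℝ) ^ (d + 1)) = (Nat.clog 2 (4 * n ^ (d + 1)) : ℤ) := by
        have := Int.clog_natCast (R := ℝ) 2 (4 * n ^ (d + 1))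
        push_cast at this
        exact this
      have h6 := (Int.ceil_lt_add_one (Real.logb 2 (4 * (n : ℝ) ^ (d + 1)))).le
      push_cast at h4
      rw [h4, h5] at h6
      exact_mod_cast h6
    have h4 : Real.logb 2 (4 * (n : ℝ) ^ (d + 1)) * Real.log 2 =
        2 * Real.log 2 + (d + 1) * Real.log n := by
      rw [Real.logb, div_mul_cancel₀ _ (by linarith : Real.log 2 ≠ 0),
        Real.log_mul (by norm_num) (by positivity), Real.log_pow,
        show (4 : ℝ) = 2 ^ 2 by norm_num, Real.log_pow]
      push_cast
      ring
    have h5 : ((Nat.clog 2 (monoBound n d * (n + 1)) : ℕ) : ℝ) ≤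
        (Nat.clog 2 (4 * n ^ (d + 1)) : ℕ) := by exact_mod_cast h2
    have h6 : Real.log n ≤ d * Real.log n := le_mul_of_one_le_left (by linarith) hd'
    -- The numerator is 4 log 2 + (d+1) log n, and log 2 ≤ log n ≤ d log n; dividing by log 2 > 1/2
    -- stays below the constant 16.
    have h7 : ((Nat.clog 2 (monoBound n d * (n + 1)) : ℝ) + 1) * Real.log 2 ≤
        6 * (d * Real.log n) := by
      have : ((Nat.clog 2 (monoBound n d * (n + 1)) : ℝ) + 1) * Real.log 2 ≤
          (Real.logb 2 (4 * (n : ℝ) ^ (d + 1)) + 2) * Real.log 2 :=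
        mul_le_mul_of_nonneg_right (by linarith) (by linarith)
      rw [add_mul (Real.logb 2 _), h4] at this
      linarith
    nlinarith
  have hcast : (complexityBound n d : ℝ) = 154 * (((n : ℝ) + 1) ^ 3 * (monoBound n d : ℝ) ^ 2 *
      ((Nat.clog 2 (monoBound n d * (n + 1)) : ℝ) + 1)) := by
    simp only [complexityBound]
    push_cast
    rfl
  rw [hcast]
  have hlogn : 0 ≤ (d : ℝ) * Real.log n := mul_nonneg (by linarith) (by linarith)
  -- For n ≥ 2 one has n + 1 ≤ 1.5 n. The constants multiply to 154 · 1.5³ · 2² · 16 = 33264.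
  calc _ ≤ 154 * ((1.5 * (n : ℝ)) ^ 3 * (2 * (n : ℝ) ^ d) ^ 2 * (16 * (d * Real.log n))) := by
        gcongr
        linarith
    _ = 33264 * (d * (n : ℝ) ^ (2 * d + 3) * Real.log n) := by ring
    _ ≤ _ := by
        gcongr
        norm_num

/-- The polynomial for fixed degree. -/
noncomputable def complexityPoly (d : ℕ) : Polynomial ℕ :=
  154 * ((Polynomial.X + 1) ^ 3 * (Polynomial.X ^ d + 1) ^ 2 *
    ((Polynomial.X ^ d + 1) * (Polynomial.X + 1) + 1))

lemma complexityBound_le_eval (n d : ℕ) : complexityBound n d ≤ (complexityPoly d).eval n := by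
  have h : (complexityPoly d).eval n =
      154 * ((n + 1) ^ 3 * monoBound n d ^ 2 * (monoBound n d * (n + 1) + 1)) := by
    simp [complexityPoly, monoBound]
  rw [h, complexityBound]
  gcongr
  -- For a polynomial bound the logarithm of x may be replaced by x, since x < 2^x.
  exact Nat.clog_le_of_le_pow Nat.lt_two_pow_self.le

theorem HaltsWithin.mono {t B B' : ℕ} {choose : PolySet n → BoolPoly n} {c : Config n}
    (h : HaltsWithin choose t B c) (hB : B ≤ B') : HaltsWithin choose t B' c := by
  induction h generalizing B' with
  | halt B A L => exact .halt B' A L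
  | step B c progress budget next ih =>
    exact .step B' c progress (fun k c' h => (budget k c' h).trans hB)
      fun k c' h => ih k c' h (Nat.sub_le_sub_right hB k)

end TriSet

theorem mainTheorem2 :
    (∃ C : ℝ, ∀ n d m : ℕ, 2 ≤ n → 1 ≤ d → 1 ≤ m →
      ∀ F : TriSet.PolySet n, F.card = m → (∀ f ∈ F, TriSet.tdeg f ≤ d) →
      ∀ choose : TriSet.PolySet n → TriSet.BoolPoly n, TriSet.IsChoose choose →
      ∀ t : ℕ, ∃ B : ℕ,
        (B : ℝ) ≤ C * (d * m * (n : ℝ) ^ (2 * d + 3) * Real.log n) ∧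
        TriSet.HaltsWithin choose t B (.start F)) ∧
    (∀ d : ℕ, ∃ p : Polynomial ℕ, ∀ n m : ℕ, 1 ≤ m →
      ∀ F : TriSet.PolySet n, F.card = m → (∀ f ∈ F, TriSet.tdeg f ≤ d) →
      ∀ choose : TriSet.PolySet n → TriSet.BoolPoly n, TriSet.IsChoose choose →
      ∀ t : ℕ, TriSet.HaltsWithin choose t (m * p.eval n) (.start F)) := by
  refine ⟨⟨100000, fun n d m hn hd hm F hF hdeg choose hch t =>
    ⟨m * TriSet.complexityBound n d, ?_, TriSet.haltsWithin_start hch hm hF hdeg⟩⟩,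
    fun d => ⟨TriSet.complexityPoly d, fun n m hm F hF hdeg choose hch t =>
      (TriSet.haltsWithin_start hch hm hF hdeg).mono
        (Nat.mul_le_mul_left m (TriSet.complexityBound_le_eval n d))⟩⟩
  have h := mul_le_mul_of_nonneg_left (TriSet.complexityBound_le hn hd) (Nat.cast_nonneg (α := ℝ) m)
  push_cast
  exact h.trans (le_of_eq (by ring))
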